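/- **Conventions.** A matrix differential operator with polynomial coefficients $D=\sum_{j=0}^m\partial^jF_j(x)$, $F_j\in\operatorname{Mat}_{M\times N}(\mathbb C[x])$, acts on the right on matrix polynomials, $P\cdot D=\sum_j P^{(j)}F_j$, and $P\cdot(DE)=(P\cdot D)\cdot E$. Put $$\Lambda_n(D)=\sum_{j}[n]_jF_j^j,\qquad [n]_j=n(n-1)\cdots(n-j+1),\ [n]_0=1,$$ where $F_j^j$ is the coefficient of $x^j$ in $F_j$; this is a matrix of polynomials in $n$. For a weight matrix $W$ of size $N$ on an interval $(x_0,x_1)$ let $\langle P,Q\rangle_W=\int_{x_0}^{x_1}P(x)W(x)Q(x)^*\,dx$. A sequence of orthogonal polynomials for $W$ is a sequence $(P_n)_{n\ge 0}$ in $\operatorname{Mat}_N(\mathbb C[x])$ with $P_n$ of degree $n$ with nonsingular leading coefficient and $\langle P_n,P_m\rangle_W=0$ for $n\ne m$. Let $\mathcal D(W)$ be the algebra of all $N\times N$ operators $D$ with polynomial coefficients such that for every $n\ge0$ there is a constant matrix $A_n$ with $P_n\cdot D=A_nP_n$ (this does not depend on the choice of $(P_n)$). The eigenvalue algebra of $W$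 is $\Lambda(W)=\{\Lambda(D):D\in\mathcal D(W)\}\subset\operatorname{Mat}_N(\mathbb C[n])$. A weight $\widetilde W$ on the same interval is a Darboux transformation of $W$ if some $D\in\mathcal D(W)$ factors as $D=\mathcal V\mathcal N$ with $\mathcal V,\mathcal N$ operators with polynomial coefficients that preserve the degree of every matrix polynomial, and $P_n\cdot\mathcal V=A_n\widetilde P_n$ for all $n$, with constant matrices $A_n$, where $P_n,\widetilde P_n$ are the monic orthogonal polynomials of $W,\widetilde W$. The classical scalar weights and their second-order operators are * shifted Hermite ($b\in\mathbb R$): $w_b=e^{-x^2+2bx}$ on $(-\infty,\infty)$, $\delta=\partial^2-2\partial(x-b)$; * Laguerre ($\alpha>-1$): $w_\alpha=e^{-x}x^\alpha$ on $(0,\infty)$, $\delta=\partial^2x+\partial(\alpha+1-x)$; * Jacobi ($\alpha,\beta>-1$): $w_{\alpha,\beta}=(1-x)^\alpha(1+x)^\beta$ on $(-1,1)$, $\delta=\partial^2(1-x^2)+\partial(\beta-\alpha-x(\alpha+\beta+2))$. For classical weights $w,\tilde w$ the operator $\mathcal T_{w,\tilde w}$ is defined as follows, for $k\in\mathbb N$: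 $\mathcal T_{w,w}=1$; $$\mathcal T_{w_\alpha,w_{\alpha+k}}=(-\partial+1)^k,\qquad \mathcal T_{w_{\alpha+k},w_\alpha}=(\partial x+\alpha+k)\cdots(\partial x+\alpha+1)$$ for Laguerre weights; $$\mathcal T_{w_{\alpha,\beta+k},w_{\alpha+k,\beta}}=(\partial(1+x)+\beta+k)\cdots(\partial(1+x)+\beta+1),$$ $$\mathcal T_{w_{\alpha+k,\beta},w_{\alpha,\beta+k}}=(\partial(x-1)+\alpha+k)\cdots(\partial(x-1)+\alpha+1)$$ for Jacobi weights; and $\mathcal T_{w,\tilde w}=0$ in all other cases. **Theorem.** Let $w_1,\dots,w_N$ be classical weights of the same type (all shifted Hermite, all Laguerre, or all Jacobi), with second-order operators $\delta_1,\dots,\delta_N$, and let $W=w_1\oplus\cdots\oplus w_N$. Then $$\Lambda(W)=\sum_{i,j=1}^N\Lambda_n(\mathcal T_{w_i,w_j})\,\mathbb C[\Lambda_n(\delta_j)]\,E_{i,j}\subset\operatorname{Mat}_N(\mathbb C[n]),$$ where $E_{i,j}$ are the matrix units, $\mathbb C[\Lambda_n(\delta)]=\mathbb C[n]$ for a shifted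 Hermite or Laguerre weight, and $\mathbb C[\Lambda_n(\delta)]=\mathbb C[n(n+\alpha+\beta+1)]$ for a Jacobi weight $w_{\alpha,\beta}$. Moreover: 1. $\Lambda_n(\mathcal T_{w,w})=1$ for every classical weight $w$, and $\Lambda_n(\mathcal T_{w,\tilde w})=0$ if the classical weight $w$ is not a Darboux transformation of the classical weight $\tilde w$. 2. For Laguerre weights, $k\in\mathbb N$, and all $n\ge0$, $$\Lambda_n(\mathcal T_{w_\alpha,w_{\alpha+k}})=1,\qquad \Lambda_n(\mathcal T_{w_{\alpha+k},w_\alpha})=\frac{\Gamma(n+\alpha+k+1)}{\Gamma(n+\alpha+1)}.$$ 3. For Jacobi weights, $k\in\mathbb N$, and all $n\ge0$, $$\Lambda_n(\mathcal T_{w_{\alpha,\beta+k},w_{\alpha+k,\beta}})=\frac{\Gamma(n+\beta+k+1)}{\Gamma(n+\beta+1)},\qquad \Lambda_n(\mathcal T_{w_{\alpha+k,\beta},w_{\alpha,\beta+k}})=\frac{\Gamma(n+\alpha+k+1)}{\Gamma(n+\alpha+1)}.$$ -/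

import Mathlib

open Polynomial

namespace MOP

noncomputable section

/-- A matrix differential operator `∑ j, ∂^j F_j(x)` with polynomial coefficients
`F_j ∈ Mat_{m × n}(ℂ[x])`, encoded by its finitely many coefficients `j ↦ F_j`. -/
abbrev DiffOp (m n : Type) : Type := ℕ →₀ Matrix m n ℂ[X]

/-- The `k`-th derivative of a matrix polynomial, taken entrywise. -/
def matDeriv {r m : Type} (k : ℕ) (P : Matrix r m ℂ[X]) : Matrix r m ℂ[X] :=
  P.map fun f => derivative^[k] f

/-- The right action `P · D = ∑ j, P^{(j)} F_j`. -/
def act {r m n : Type} [Fintype m] (P : Matrix r m ℂ[X]) (D : DiffOp m n) :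
    Matrix r n ℂ[X] :=
  D.sum fun j F => matDeriv j P * F

/-- The product `D E` of differential operators for the right action (first `D`, then `E`),
given on monomials by the Leibniz rule
`(∂^i F)(∂^j G) = ∑_{l ≤ j} (j choose l) ∂^{i+l} F^{(j-l)} G`. -/
def comp {m n r : Type} [Fintype n] (D : DiffOp m n) (E : DiffOp n r) : DiffOp m r :=
  D.sum fun i F => E.sum fun j G =>
    ∑ l ∈ Finset.range (j + 1),
      Finsupp.single (i + l) ((j.choose l) • (matDeriv (j - l) F * G))

/-- `Λ(D) = ∑ j, [n]_j F_j^j`, with `F_j^j` the coefficient of `x^j` in `F_j` and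
`[n]_j = n (n-1) ⋯ (n-j+1)`. It is a matrix of polynomials in the variable `n`, which is
written `X` here; `Λ_n(D)` is the value at `n`. -/
def Lam {m n : Type} (D : DiffOp m n) : Matrix m n ℂ[X] :=
  D.sum fun j F => F.map fun f => C (f.coeff j) * descPochhammer ℂ j

/-- A (not necessarily normalized) weight matrix of size `N`: the interval on which it lives and
its density there. -/
structure Weight (N : ℕ) where
  /-- the interval `(x₀, x₁)` -/
  supp : Set ℝ
  /-- the density -/
  dens : ℝ → Matrix (Fin N) (Fin N) ℂ

/-- The value `P(x)` of a matrix polynomial at a real point. -/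
def matEval {m n : Type} (P : Matrix m n ℂ[X]) (x : ℝ) : Matrix m n ℂ :=
  P.map fun f => f.eval (x : ℂ)

/-- `⟨P, Q⟩_W = ∫ P(x) W(x) Q(x)^* dx`, a matrix, integrated entrywise. -/
def inner {N : ℕ} (W : Weight N) (P Q : Matrix (Fin N) (Fin N) ℂ[X]) :
    Matrix (Fin N) (Fin N) ℂ :=
  Matrix.of fun i j =>
    ∫ x in W.supp, (matEval P x * W.dens x * (matEval Q x).conjTranspose) i j

/-- The matrix of the coefficients of `x^k`. -/
def matCoeff {m n : Type} (P : Matrix m n ℂ[X]) (k : ℕ) : Matrix m n ℂ :=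
  P.map fun f => f.coeff k

/-- `P` is a sequence of matrix orthogonal polynomials for `W`: `P_n` has degree `n` with
nonsingular leading coefficient, and `⟨P_n, P_m⟩_W = 0` for `n ≠ m`. -/
structure IsOrthogonalSeq {N : ℕ} (W : Weight N)
    (P : ℕ → Matrix (Fin N) (Fin N) ℂ[X]) : Prop where
  degree_le : ∀ n i j, (P n i j).degree ≤ n
  leading : ∀ n, IsUnit (matCoeff (P n) n)
  orth : ∀ n m, n ≠ m → inner W (P n) (P m) = 0

/-- A sequence of orthogonal polynomials whose leading coefficients are the identity. -/
structure IsMonicOrthogonalSeq {N : ℕ} (W : Weight N)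
    (P : ℕ → Matrix (Fin N) (Fin N) ℂ[X]) : Prop extends IsOrthogonalSeq W P where
  monic : ∀ n, matCoeff (P n) n = 1

/-- The algebra `𝒟(W)` of the differential operators with polynomial coefficients that have the
orthogonal polynomials of `W` as eigenfunctions, `P_n · D = A_n P_n` with constant matrices
`A_n`. -/
def diffAlgebra {N : ℕ} (W : Weight N) : Set (DiffOp (Fin N) (Fin N)) :=
  {D | ∀ P, IsOrthogonalSeq W P →
    ∀ n, ∃ A : Matrix (Fin N) (Fin N) ℂ, act (P n) D = A.map C * P n}

/-- The eigenvalue algebra `Λ(W) = {Λ(D) : D ∈ 𝒟(W)}`, inside `Mat_N(ℂ[n])`. -/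
def eigenvalueAlgebra {N : ℕ} (W : Weight N) : Set (Matrix (Fin N) (Fin N) ℂ[X]) :=
  Lam '' diffAlgebra W

/-- The degree of a matrix polynomial (`⊥` for the zero polynomial). -/
def matDegree {m n : Type} [Fintype m] [Fintype n] (P : Matrix m n ℂ[X]) : WithBot ℕ :=
  Finset.univ.sup fun i => Finset.univ.sup fun j => (P i j).degree

/-- `deg (P · V) = deg P` for all matrix polynomials `P`. -/
def DegreePreserving {N : ℕ} (V : DiffOp (Fin N) (Fin N)) : Prop :=
  ∀ P : Matrix (Fin N) (Fin N) ℂ[X], matDegree (act P V) = matDegree P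

/-- `W'` is a Darboux transformation of `W`: both live on the same interval, and some
`D ∈ 𝒟(W)` factors as `D = 𝒱 𝒩` with degree-preserving `𝒱`, `𝒩` such that
`P_n · 𝒱 = A_n P'_n` for the monic orthogonal polynomials `P_n` of `W` and `P'_n` of `W'`. -/
def IsDarboux {N : ℕ} (W W' : Weight N) : Prop :=
  W.supp = W'.supp ∧
  ∃ D ∈ diffAlgebra W, ∃ V N' : DiffOp (Fin N) (Fin N),
    D = comp V N' ∧ DegreePreserving V ∧ DegreePreserving N' ∧
    ∀ P P', IsMonicOrthogonalSeq W P → IsMonicOrthogonalSeq W' P' →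
      ∀ n, ∃ A : Matrix (Fin N) (Fin N) ℂ, act (P n) V = A.map C * P' n

/-- The scalar operator `∂^k f(x)`, as a `1 × 1` operator. -/
def sop (k : ℕ) (f : ℂ[X]) : DiffOp (Fin 1) (Fin 1) := Finsupp.single k !![f]

/-- The classical scalar weights: shifted Hermite, Laguerre and Jacobi. -/
inductive Classical : Type
  | hermite (b : ℝ)
  | laguerre (α : ℝ) (hα : -1 < α)
  | jacobi (α β : ℝ) (hα : -1 < α) (hβ : -1 < β)

namespace Classical

/-- The interval: `(-∞, ∞)`, `(0, ∞)`, `(-1, 1)`. -/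
def interval : Classical → Set ℝ
  | hermite _ => Set.univ
  | laguerre _ _ => Set.Ioi 0
  | jacobi _ _ _ _ => Set.Ioo (-1) 1

/-- The density: `e^{-x²+2bx}`, `e^{-x} x^α`, `(1-x)^α (1+x)^β`. -/
def density : Classical → ℝ → ℝ
  | hermite b => fun x => Real.exp (-x ^ 2 + 2 * b * x)
  | laguerre α _ => fun x => Real.exp (-x) * x ^ α
  | jacobi α β _ _ => fun x => (1 - x) ^ α * (1 + x) ^ β

/-- A classical weight as a weight matrix of size `1`. -/
def weight (w : Classical) : Weight 1 where
  supp := w.interval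
  dens x := !![(w.density x : ℂ)]

/-- Both weights are shifted Hermite, or both are Laguerre, or both are Jacobi. -/
def SameType : Classical → Classical → Prop
  | hermite _, hermite _ => True
  | laguerre _ _, laguerre _ _ => True
  | jacobi _ _ _ _, jacobi _ _ _ _ => True
  | _, _ => False

/-- The second-order operator `δ` of a classical weight. -/
def delta : Classical → DiffOp (Fin 1) (Fin 1)
  | hermite b => sop 2 1 + sop 1 (-2 * (X - C (b : ℂ)))
  | laguerre α _ => sop 2 X + sop 1 (C ((α : ℂ) + 1) - X)
  | jacobi α β _ _ =>
      sop 2 (1 - X ^ 2) + sop 1 (C ((β : ℂ) - α) - X * C ((α : ℂ) + β + 2))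

/-- `(-∂ + 1)^k` -/
def oneSubPow : ℕ → DiffOp (Fin 1) (Fin 1)
  | 0 => sop 0 1
  | k + 1 => comp (sop 1 (-1) + sop 0 1) (oneSubPow k)

/-- `(∂ f + c + k) (∂ f + c + k - 1) ⋯ (∂ f + c + 1)` -/
def shiftProd (f : ℂ[X]) (c : ℝ) : ℕ → DiffOp (Fin 1) (Fin 1)
  | 0 => sop 0 1
  | k + 1 => comp (sop 1 f + sop 0 (C ((c : ℂ) + (k + 1 : ℕ)))) (shiftProd f c k)

open scoped _root_.Classical in
/-- The operators `𝒯_{w, w'}`: `1` for `w = w'`; for two Laguerre weights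
`(-∂+1)^k` from `α` to `α + k`, and `(∂x + α + k) ⋯ (∂x + α + 1)` from `α + k` to `α`;
for two Jacobi weights `(∂(1+x) + β + k) ⋯ (∂(1+x) + β + 1)` from `(α, β + k)` to `(α + k, β)`,
and `(∂(x-1) + α + k) ⋯ (∂(x-1) + α + 1)` from `(α + k, β)` to `(α, β + k)`; and `0` in all other
cases. (The natural number `k` is determined by the parameters, and `k = 0` gives `1`.) -/
def T : Classical → Classical → DiffOp (Fin 1) (Fin 1)
  | hermite b, hermite b' => if b = b' then sop 0 1 else 0
  | laguerre α _, laguerre α' _ =>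
      if h : ∃ k : ℕ, α' = α + k then oneSubPow h.choose
      else if h : ∃ k : ℕ, α = α' + k then shiftProd X α' h.choose
      else 0
  | jacobi α β _ _, jacobi α' β' _ _ =>
      if h : ∃ k : ℕ, α' = α + k ∧ β = β' + k then shiftProd (1 + X) β' h.choose
      else if h : ∃ k : ℕ, α = α' + k ∧ β' = β + k then shiftProd (X - 1) α' h.choose
      else 0
  | _, _ => 0

/-- The polynomial `Λ_n(D)` in `n` of a scalar operator `D`. -/
def lam (D : DiffOp (Fin 1) (Fin 1)) : ℂ[X] := Lam D 0 0

/-- The algebra `ℂ[Λ_n(δ)] ⊆ ℂ[n]` of a classical weight. -/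
def eigAlg (w : Classical) : Subalgebra ℂ ℂ[X] := Algebra.adjoin ℂ {lam w.delta}

end Classical

/-- The direct sum `w_1 ⊕ ⋯ ⊕ w_N` of classical weights on the common interval (the intersection
of the intervals, which is the interval of each `w_j` when they are of the same type). -/
def directSum {N : ℕ} (w : Fin N → Classical) : Weight N where
  supp := ⋂ j, (w j).interval
  dens x := Matrix.diagonal fun j => ((w j).density x : ℂ)

/-- The subspace `Λ_n(𝒯_{w,w'}) ℂ[Λ_n(δ_{w'})] E_{i,j}` of `Mat_N(ℂ[n])`. -/
def entrySpace {N : ℕ} (w w' : Classical) (i j : Fin N) :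
    Submodule ℂ (Matrix (Fin N) (Fin N) ℂ[X]) :=
  (Subalgebra.toSubmodule w'.eigAlg).map
    (Matrix.singleLinearMap ℂ i j ∘ₗ LinearMap.mulLeft ℂ (Classical.lam (Classical.T w w')))

end

end MOP

/-! Let p_n and q_n be the monic orthogonal polynomials of `w i` and `w j`; they are the
eigenpolynomials of the second-order operators. Every orthogonal sequence of the direct sum is a
constant left multiple of the diagonal sequence, so an operator lies in 𝒟(W) exactly when each entry
D of it satisfies p_n · D = λ(n) q_n, and λ is then Λ(D), read off from leading coefficients
(`mem_diffAlgebra_iff`). Entries can be chosen independently, so the theorem reduces to finding, for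
two classical weights w and w', all λ that occur (`exists_maps_iff`).

The claimed λ do occur. The first-order factors of 𝒯 intertwine second-order operators with equal
eigenvalues, hence carry eigenpolynomials to eigenpolynomials; composing with polynomials in the
operator δ' of w' gives the factor from ℂ[Λ(δ')].

No others occur. At a singular point x₀ with exponent e (0 for Laguerre, ±1 for Jacobi), the
equation δf = μf makes every Taylor coefficient of f equal to f(x₀) times a polynomial in μ.
Evaluating p_n · D = λ(n) q_n at x₀ gives λ(n) q_n(x₀) = A(μ_n) p_n(x₀) with A a polynomial
(`eval_app`). If the eigenvalues of the two weights agree, then p_n(x₀)/q_n(x₀) = (e+1)_n/(e'+1)_n.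
For e - e' = k ∈ ℕ this is the eigenvalue of a product of k lowering factors up to a constant, which
gives the claim; for e - e' not an integer no nonzero rational function of n is proportional to the
ratio in this way, and λ = 0.

The other cases are separate. If Λ(𝒯) = 1 and ℂ[Λ(δ')] = ℂ[n], nothing is left to prove. For Jacobi
weights with different α + β, the reflection n ↦ -n-α-β-1 fixes the eigenvalue of w but not that of
w', and comparing values with first derivatives at 1 forces λ = 0. For different Hermite shifts, the
top coefficient F of D satisfies F' = (b - b')F, which has no nonzero polynomial solution.

For the Darboux statement, a nonzero 𝒯 comes with a reverse 𝒯, and both have eigenvalues without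
zeros in ℕ; their composition is the required factorization. -/

namespace MOP

noncomputable section

/-! ### Scalar action, entries and composition of operators -/

/-- The scalar action of a `1 × 1` operator. -/
def app (D : DiffOp (Fin 1) (Fin 1)) : ℂ[X] →ₗ[ℂ] ℂ[X] :=
  D.sum fun j F => LinearMap.mulRight ℂ (F 0 0) ∘ₗ (derivative ^ j)

theorem app_apply (D : DiffOp (Fin 1) (Fin 1)) (f : ℂ[X]) :
    app D f = D.sum fun j F => derivative^[j] f * F 0 0 := by
  simp [app, Finsupp.sum, LinearMap.sum_apply, Module.End.pow_apply]

/-- The `(i, j)` entry of a matrix differential operator. -/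
def entry {m n : Type} (D : DiffOp m n) (i : m) (j : n) : DiffOp (Fin 1) (Fin 1) :=
  D.mapRange (fun M => !![M i j]) (by ext a b; fin_cases a; fin_cases b; simp)

theorem app_entry {m n : Type} (D : DiffOp m n) (i : m) (j : n) (f : ℂ[X]) :
    app (entry D i j) f = D.sum fun k F => derivative^[k] f * F i j := by
  rw [app_apply, entry, Finsupp.sum_mapRange_index (by simp)]
  simp

theorem act_apply {r m n : Type} [Fintype m] (P : Matrix r m ℂ[X]) (D : DiffOp m n) (i : r)
    (j : n) : act P D i j = ∑ l, app (entry D l j) (P i l) := by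
  simp only [app_entry, act, Finsupp.sum, Matrix.sum_apply, Matrix.mul_apply, matDeriv,
    Matrix.map_apply]
  exact Finset.sum_comm

theorem lam_entry {m n : Type} (D : DiffOp m n) (i : m) (j : n) :
    Classical.lam (entry D i j) = Lam D i j := by
  unfold Classical.lam Lam entry
  rw [Finsupp.sum_mapRange_index (by intro; ext a b; simp)]
  simp [Finsupp.sum, Matrix.sum_apply]

theorem lam_apply (D : DiffOp (Fin 1) (Fin 1)) :
    Classical.lam D = D.sum fun j F => C ((F 0 0).coeff j) * descPochhammer ℂ j := by
  simp [Classical.lam, Lam, Finsupp.sum, Matrix.sum_apply]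

theorem lam_add (D E : DiffOp (Fin 1) (Fin 1)) :
    Classical.lam (D + E) = Classical.lam D + Classical.lam E := by
  simp only [lam_apply]
  rw [Finsupp.sum_add_index'] <;> intros <;> simp [add_mul]

theorem lam_zero : Classical.lam 0 = 0 := by
  simp [lam_apply]

theorem lam_sop (k : ℕ) (f : ℂ[X]) :
    Classical.lam (sop k f) = C (f.coeff k) * descPochhammer ℂ k := by
  rw [lam_apply, sop, Finsupp.sum_single_index (by simp)]
  simp

@[simp] theorem app_zero_op (f : ℂ[X]) : app 0 f = 0 := by
  simp [app_apply]

@[simp] theorem app_add_op (D E : DiffOp (Fin 1) (Fin 1)) (f : ℂ[X]) :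
    app (D + E) f = app D f + app E f := by
  simp only [app_apply]
  rw [Finsupp.sum_add_index'] <;> intros <;> simp [mul_add]

@[simp] theorem app_sop (k : ℕ) (g f : ℂ[X]) : app (sop k g) f = derivative^[k] f * g := by
  rw [app_apply, sop, Finsupp.sum_single_index (by simp)]
  simp

theorem app_C_mul (D : DiffOp (Fin 1) (Fin 1)) (c : ℂ) (f : ℂ[X]) :
    app D (C c * f) = C c * app D f := by
  rw [← smul_eq_C_mul, map_smul, smul_eq_C_mul]

theorem matDeriv_mul {r m n : Type} [Fintype m] (k : ℕ) (P : Matrix r m ℂ[X])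
    (F : Matrix m n ℂ[X]) : matDeriv k (P * F) =
      ∑ l ∈ Finset.range (k + 1), k.choose l • (matDeriv l P * matDeriv (k - l) F) := by
  ext1 i j
  simp only [matDeriv, Matrix.map_apply, Matrix.mul_apply, Matrix.sum_apply, Matrix.smul_apply,
    Finset.smul_sum]
  rw [iterate_derivative_sum, Finset.sum_comm]
  refine Finset.sum_congr rfl fun a _ => ?_
  rw [mul_comm, iterate_derivative_mul]
  exact Finset.sum_congr rfl fun l _ => by rw [mul_comm]

theorem matDeriv_matDeriv {r m : Type} (k l : ℕ) (P : Matrix r m ℂ[X]) :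
    matDeriv k (matDeriv l P) = matDeriv (k + l) P := by
  ext1 i j
  simp [matDeriv, Function.iterate_add_apply]

theorem matDeriv_sum {r m : Type} {ι : Type} (k : ℕ) (s : Finset ι) (P : ι → Matrix r m ℂ[X]) :
    matDeriv k (∑ i ∈ s, P i) = ∑ i ∈ s, matDeriv k (P i) := by
  ext1 i j
  simp [matDeriv, Matrix.sum_apply, iterate_derivative_sum]

theorem act_add {r m n : Type} [Fintype m] (P : Matrix r m ℂ[X]) (D E : DiffOp m n) :
    act P (D + E) = act P D + act P E := by
  unfold act
  rw [Finsupp.sum_add_index'] <;> intros <;> simp [Matrix.mul_add]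

theorem act_sum {r m n ι : Type} [Fintype m] (P : Matrix r m ℂ[X]) (s : Finset ι)
    (D : ι → DiffOp m n) : act P (∑ i ∈ s, D i) = ∑ i ∈ s, act P (D i) := by
  classical
  induction s using Finset.induction_on with
  | empty => simp [act]
  | insert a s ha ih => rw [Finset.sum_insert ha, act_add, ih, Finset.sum_insert ha]

theorem act_single {r m n : Type} [Fintype m] (P : Matrix r m ℂ[X]) (k : ℕ)
    (F : Matrix m n ℂ[X]) : act P (Finsupp.single k F) = matDeriv k P * F := by
  rw [act, Finsupp.sum_single_index (by simp)]

/-- The right action is an action. -/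
theorem act_comp {r m n q : Type} [Fintype m] [Fintype n] (P : Matrix r m ℂ[X])
    (D : DiffOp m n) (E : DiffOp n q) : act P (comp D E) = act (act P D) E := by
  have h (j : ℕ) (G : Matrix n q ℂ[X]) : matDeriv j (act P D) * G = D.sum fun i F =>
      ∑ l ∈ Finset.range (j + 1), act P (Finsupp.single (i + l)
        ((j.choose l) • (matDeriv (j - l) F * G))) := by
    simp only [act, Finsupp.sum]
    rw [matDeriv_sum, Matrix.sum_mul]
    refine Finset.sum_congr rfl fun i _ => ?_
    rw [matDeriv_mul, Matrix.sum_mul]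
    refine Finset.sum_congr rfl fun l _ => ?_
    have := act_single P (i + l) (j.choose l • (matDeriv (j - l) (D i) * G))
    rw [act, Finsupp.sum] at this
    rw [this, matDeriv_matDeriv, Matrix.smul_mul, Matrix.mul_smul, Matrix.mul_assoc, add_comm l]
  conv_rhs => rw [act]
  simp only [h, comp, Finsupp.sum, act_sum]
  exact Finset.sum_comm

theorem app_eq_act (D : DiffOp (Fin 1) (Fin 1)) (f : ℂ[X]) : app D f = act !![f] D 0 0 := by
  rw [act_apply]
  have : entry D 0 0 = D := by
    ext1 k
    ext1 a b
    fin_cases a; fin_cases b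
    simp [entry]
  simp [this]

theorem act_one_one (D : DiffOp (Fin 1) (Fin 1)) (P : Matrix (Fin 1) (Fin 1) ℂ[X]) :
    act P D = !![app D (P 0 0)] := by
  ext1 a b
  fin_cases a; fin_cases b
  rw [app_eq_act]
  have : P = !![P 0 0] := by ext1 a b; fin_cases a; fin_cases b; rfl
  conv_lhs => rw [this]
  rfl

@[simp] theorem app_comp (D E : DiffOp (Fin 1) (Fin 1)) (f : ℂ[X]) :
    app (comp D E) f = app E (app D f) := by
  rw [app_eq_act, act_comp, act_one_one, act_one_one]
  rfl

/-! ### Operators that do not raise degrees -/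

/-- If `D` does not raise the degrees of the monomials, its `j`-th coefficient has degree at
most `j`. -/
theorem degree_coeff_le_of_degree_app_le {D : DiffOp (Fin 1) (Fin 1)}
    (h : ∀ n : ℕ, (app D (X ^ n)).degree ≤ n) (j : ℕ) : (D j 0 0).degree ≤ j := by
  induction j using Nat.strong_induction_on with
  | _ j ih =>
    -- Terms of order above j kill X^j, order j contributes j! F_j, and the lower orders have degree
    -- at most j by induction; so F_j inherits the bound.
    have key : app D (X ^ j) = C ((j.factorial : ℂ)) * D j 0 0 +
        ∑ i ∈ D.support with i < j, derivative^[i] (X ^ j) * D i 0 0 := by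
      rw [app_apply, Finsupp.sum]
      rw [← Finset.sum_filter_add_sum_filter_not _ (fun i => i < j)]
      rw [add_comm]
      congr 1
      by_cases hj : j ∈ D.support
      · rw [Finset.sum_eq_single_of_mem j (by simpa using hj)]
        · rw [iterate_derivative_X_pow_eq_C_mul]
          simp [Nat.descFactorial_self]
        · intro b hb hbj
          simp only [not_lt, Finset.mem_filter] at hb
          rw [iterate_derivative_X_pow_eq_C_mul,
            Nat.descFactorial_of_lt (lt_of_le_of_ne hb.2 hbj.symm)]
          simp
      · rw [Finsupp.notMem_support_iff.1 hj]
        simp only [Matrix.zero_apply, mul_zero]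
        refine Finset.sum_eq_zero fun b hb => ?_
        simp only [not_lt, Finset.mem_filter] at hb
        have : j < b := lt_of_le_of_ne hb.2 (fun e => hj (e ▸ hb.1))
        rw [iterate_derivative_X_pow_eq_C_mul, Nat.descFactorial_of_lt this]
        simp
    have h2 : (C ((j.factorial : ℂ)) * D j 0 0).degree ≤ j := by
      rw [eq_sub_of_add_eq key.symm]
      refine (degree_sub_le _ _).trans (max_le (h j) ?_)
      refine (degree_sum_le _ _).trans (Finset.sup_le fun i hi => ?_)
      simp only [Finset.mem_filter] at hi
      rw [iterate_derivative_X_pow_eq_C_mul, mul_assoc, ← smul_eq_C_mul]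
      refine (degree_smul_le _ _).trans ?_
      refine (degree_mul_le _ _).trans ?_
      refine (add_le_add (degree_X_pow_le _) (ih i hi.2)).trans ?_
      rw [← Nat.cast_add, Nat.sub_add_cancel hi.2.le]
    rwa [degree_C_mul (by exact_mod_cast j.factorial_ne_zero)] at h2

theorem eval_descPochhammer_natCast (n j : ℕ) :
    (descPochhammer ℂ j).eval (n : ℂ) = n.descFactorial j :=
  descPochhammer_eval_eq_descFactorial ℂ n j

/-- The leading coefficient of `f · D` for an operator that does not raise degrees. -/
theorem coeff_app {D : DiffOp (Fin 1) (Fin 1)} (hD : ∀ j, (D j 0 0).degree ≤ j)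
    {f : ℂ[X]} {n : ℕ} (hf : f.degree ≤ n) :
    (app D f).degree ≤ n ∧ (app D f).coeff n = (Classical.lam D).eval (n : ℂ) * f.coeff n := by
  rw [app_apply, lam_apply]
  simp only [Finsupp.sum, eval_finsetSum, finsetSum_coeff, Finset.sum_mul]
  have deg (j : ℕ) : (derivative^[j] f).natDegree ≤ n - j :=
    (natDegree_iterate_derivative f j).trans
      (Nat.sub_le_sub_right (natDegree_le_iff_degree_le.2 hf) _)
  have vanish (j : ℕ) (hj : n < j) : derivative^[j] f = 0 :=
    iterate_derivative_eq_zero ((natDegree_le_iff_degree_le.2 hf).trans_lt hj)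
  have hD' (j : ℕ) : (D j 0 0).natDegree ≤ j := natDegree_le_iff_degree_le.2 (hD j)
  constructor
  · refine (degree_sum_le _ _).trans (Finset.sup_le fun j _ => ?_)
    by_cases hj : n < j
    · simp [vanish j hj]
    · refine natDegree_le_iff_degree_le.1 (natDegree_mul_le.trans ?_)
      have := deg j
      have := hD' j
      omega
  · refine Finset.sum_congr rfl fun j _ => ?_
    by_cases hj : n < j
    · simp [vanish j hj, eval_descPochhammer_natCast, Nat.descFactorial_of_lt hj]
    -- The j-th derivative has degree at most n - j and the coefficient degree at most j, so the
    -- coefficient of x^n is the product of the two top ones.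
    · obtain ⟨k, rfl⟩ := Nat.exists_eq_add_of_le (not_lt.1 hj)
      have h1 := deg j
      rw [Nat.add_sub_cancel_left] at h1
      rw [add_comm j k, coeff_mul_add_eq_of_natDegree_le h1 (hD' j), coeff_iterate_derivative]
      rw [add_comm k j, eval_mul, eval_descPochhammer_natCast, eval_C, nsmul_eq_mul]
      ring

theorem eq_of_eval_natCast {p q : ℂ[X]} (h : ∀ n : ℕ, p.eval (n : ℂ) = q.eval (n : ℂ)) :
    p = q := by
  refine eq_of_infinite_eval_eq p q ((Set.infinite_range_of_injective
    (Nat.cast_injective (R := ℂ))).mono ?_)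
  rintro _ ⟨n, rfl⟩
  exact h n

/-! ### Second-order operators and their eigenpolynomials -/

namespace Classical

/-- The leading coefficient of the second-order operator of a classical weight. -/
def sigma : Classical → ℂ[X]
  | hermite _ => 1
  | laguerre _ _ => X
  | jacobi _ _ _ _ => 1 - X ^ 2

/-- The first-order coefficient of the second-order operator of a classical weight. -/
def tau : Classical → ℂ[X]
  | hermite b => -2 * (X - C (b : ℂ))
  | laguerre α _ => C ((α : ℂ) + 1) - X
  | jacobi α β _ _ => C ((β : ℂ) - α) - X * C ((α : ℂ) + β + 2)

theorem delta_eq (w : Classical) : w.delta = sop 2 w.sigma + sop 1 w.tau := by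
  cases w <;> rfl

theorem app_delta (w : Classical) (f : ℂ[X]) :
    app w.delta f = derivative (derivative f) * w.sigma + derivative f * w.tau := by
  simp [delta_eq]

theorem sigma_degree (w : Classical) : w.sigma.degree ≤ 2 := by
  cases w <;> simp only [sigma] <;> compute_degree!

theorem tau_degree (w : Classical) : w.tau.degree ≤ 1 := by
  cases w <;> simp only [tau] <;> compute_degree!

theorem delta_degree (w : Classical) (j : ℕ) : (w.delta j 0 0).degree ≤ j := by
  rw [delta_eq]
  simp only [sop, Finsupp.add_apply, Finsupp.single_apply]
  split_ifs with h1 h2 h2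
  · omega
  · subst h1; simpa using w.sigma_degree
  · subst h2; simpa using w.tau_degree
  · simp

theorem descPochhammer_two : descPochhammer ℂ 2 = X * (X - 1) := by
  rw [show 2 = 1 + 1 from rfl, descPochhammer_succ_right, descPochhammer_one]
  simp

theorem lam_delta_hermite (b : ℝ) : lam (hermite b).delta = C (-2) * X := by
  have h : (-2 * (X - C (b : ℂ)) : ℂ[X]) = C (-2) * X - C (-2) * C (b : ℂ) := by
    simp only [map_neg, C_ofNat]
    ring
  rw [delta, lam_add, lam_sop, lam_sop, h, descPochhammer_two, descPochhammer_one]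
  simp [coeff_one, coeff_C]

theorem lam_delta_laguerre (α : ℝ) (hα : -1 < α) : lam (laguerre α hα).delta = -X := by
  rw [delta, lam_add, lam_sop, lam_sop, descPochhammer_two, descPochhammer_one]
  simp [coeff_one, coeff_X]

theorem lam_delta_jacobi (α β : ℝ) (hα : -1 < α) (hβ : -1 < β) :
    lam (jacobi α β hα hβ).delta = -(X * (X + C ((α : ℂ) + β + 1))) := by
  rw [delta, lam_add, lam_sop, lam_sop, descPochhammer_two, descPochhammer_one]
  have h2 : C (2 : ℂ) = 2 := map_ofNat C 2
  simp [coeff_one, coeff_C, h2]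
  ring

/-- In the Jacobi case the difference of eigenvalues has the factors m - n and m + n + α + β + 1;
for m ≠ n the second is positive, because m + n ≥ 1 and α + β > -2. -/
theorem lam_delta_eval_injective (w : Classical) {m n : ℕ}
    (h : (lam w.delta).eval (m : ℂ) = (lam w.delta).eval (n : ℂ)) : m = n := by
  cases w with
  | hermite b => simpa [lam_delta_hermite] using h
  | laguerre α hα => simpa [lam_delta_laguerre] using h
  | jacobi α β hα hβ =>
    by_contra hne
    simp only [lam_delta_jacobi, eval_neg, eval_mul, eval_X, eval_add, eval_C] at h
    have h' : ((m : ℝ) - n) * (m + n + α + β + 1) = 0 := by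
      have : ((m : ℂ) - n) * (m + n + α + β + 1) = 0 := by linear_combination -h
      exact_mod_cast this
    rcases mul_eq_zero.1 h' with h0 | h0
    · exact hne (by exact_mod_cast sub_eq_zero.1 h0)
    · have : (1 : ℝ) ≤ m + n := by
        have : 1 ≤ m + n := by omega
        exact_mod_cast this
      linarith

theorem degree_lt_of_coeff_eq_zero {f : ℂ[X]} {n : ℕ} (hf : f.degree ≤ n)
    (h : f.coeff n = 0) : f.degree < n := by
  rw [degree_lt_iff_coeff_zero]
  intro m hm
  rcases hm.eq_or_lt with rfl | hm
  · exact h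
  · exact coeff_eq_zero_of_degree_lt (hf.trans_lt (by exact_mod_cast hm))

/-- On polynomials of degree below k ≤ n, the operator δ - μ_n is triangular with diagonal entries
μ_j - μ_n, j < n, all nonzero; so it is onto. -/
theorem exists_delta_sub_eq (w : Classical) (n k : ℕ) (hk : k ≤ n) (g : ℂ[X])
    (hg : g.degree < k) : ∃ h : ℂ[X], h.degree < k ∧
      app w.delta h - C ((lam w.delta).eval (n : ℂ)) * h = g := by
  induction k generalizing g with
  | zero =>
    refine ⟨0, by simp, ?_⟩
    have : g = 0 := by simpa using hg
    simp [this]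
  | succ k ih =>
    have hne : (lam w.delta).eval (k : ℂ) - (lam w.delta).eval (n : ℂ) ≠ 0 :=
      sub_ne_zero.2 fun e => by
        have := w.lam_delta_eval_injective e
        omega
    -- Chosen so that the image of c X^k has the same coefficient of X^k as g, leaving a remainder
    -- of lower degree.
    set c := g.coeff k / ((lam w.delta).eval (k : ℂ) - (lam w.delta).eval (n : ℂ)) with hc
    have hX : (C c * X ^ k : ℂ[X]).degree ≤ k := degree_C_mul_X_pow_le k c
    have hgk : g.degree ≤ k := by
      rw [degree_le_iff_coeff_zero]
      intro m hm
      exact (degree_lt_iff_coeff_zero _ _).1 hg m (by exact_mod_cast hm)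
    obtain ⟨h1, h2⟩ := coeff_app w.delta_degree hX
    obtain ⟨h, hh, e⟩ := ih (by omega)
      (g - (app w.delta (C c * X ^ k) - C ((lam w.delta).eval (n : ℂ)) * (C c * X ^ k))) (by
        apply degree_lt_of_coeff_eq_zero
        · refine (degree_sub_le _ _).trans (max_le hgk ((degree_sub_le _ _).trans (max_le h1 ?_)))
          rw [← smul_eq_C_mul]
          exact (degree_smul_le _ _).trans hX
        · have h3 : c * ((lam w.delta).eval (k : ℂ) - (lam w.delta).eval (n : ℂ)) = g.coeff k :=
            div_mul_cancel₀ _ hne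
          have h4 : (C c * X ^ k : ℂ[X]).coeff k = c := by simp
          rw [coeff_sub, coeff_sub, h2, h4, coeff_C_mul, h4]
          linear_combination -h3)
    refine ⟨h + C c * X ^ k, ?_, ?_⟩
    · refine (degree_add_le _ _).trans_lt (max_lt (hh.trans ?_) (hX.trans_lt ?_)) <;>
        exact_mod_cast Nat.lt_succ_self k
    · rw [map_add, mul_add]
      linear_combination e

/-- (δ - μ_n) X^n has degree below n, so a correction of X^n by lower-degree terms removes it. -/
theorem exists_eigenpolynomial (w : Classical) (n : ℕ) : ∃ p : ℂ[X], p.degree ≤ n ∧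
    p.coeff n = 1 ∧ app w.delta p = C ((lam w.delta).eval (n : ℂ)) * p := by
  have hX : (X ^ n : ℂ[X]).degree ≤ n := degree_X_pow_le n
  obtain ⟨h1, h2⟩ := coeff_app w.delta_degree hX
  obtain ⟨h, hh, e⟩ := exists_delta_sub_eq w n n le_rfl
    (app w.delta (X ^ n) - C ((lam w.delta).eval (n : ℂ)) * X ^ n) (by
      apply degree_lt_of_coeff_eq_zero
      · refine (degree_sub_le _ _).trans (max_le h1 ?_)
        rw [← smul_eq_C_mul]
        exact (degree_smul_le _ _).trans hX
      · rw [coeff_sub, h2, coeff_C_mul, sub_self])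
  refine ⟨X ^ n - h, ?_, ?_, ?_⟩
  · exact (degree_sub_le _ _).trans (max_le hX hh.le)
  · rw [coeff_sub, coeff_X_pow_self, coeff_eq_zero_of_degree_lt hh, sub_zero]
  · rw [map_sub]
    linear_combination -e

/-- The monic eigenpolynomial of degree `n` of the second-order operator; it is the monic
orthogonal polynomial of the weight. -/
def poly (w : Classical) (n : ℕ) : ℂ[X] := (w.exists_eigenpolynomial n).choose

theorem poly_degree_le (w : Classical) (n : ℕ) : (w.poly n).degree ≤ n :=
  (w.exists_eigenpolynomial n).choose_spec.1

theorem poly_coeff_self (w : Classical) (n : ℕ) : (w.poly n).coeff n = 1 :=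
  (w.exists_eigenpolynomial n).choose_spec.2.1

theorem app_delta_poly (w : Classical) (n : ℕ) :
    app w.delta (w.poly n) = C ((lam w.delta).eval (n : ℂ)) * w.poly n :=
  (w.exists_eigenpolynomial n).choose_spec.2.2

theorem poly_ne_zero (w : Classical) (n : ℕ) : w.poly n ≠ 0 := fun h => by
  simpa [h] using w.poly_coeff_self n

/-- Eigenpolynomials are multiples of the monic ones. -/
theorem eq_C_mul_poly (w : Classical) {n : ℕ} {f : ℂ[X]}
    (hf : app w.delta f = C ((lam w.delta).eval (n : ℂ)) * f) :
    f = C (f.coeff n) * w.poly n := by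
  by_contra hne
  set g := f - C (f.coeff n) * w.poly n with hg
  have hg0 : g ≠ 0 := sub_ne_zero.2 hne
  have hge : app w.delta g = C ((lam w.delta).eval (n : ℂ)) * g := by
    rw [hg, map_sub, app_C_mul, hf, app_delta_poly]
    ring
  have h2 := (coeff_app w.delta_degree (f := g) degree_le_natDegree).2
  rw [hge, coeff_C_mul] at h2
  have hlead : g.coeff g.natDegree ≠ 0 := by simpa using hg0
  have hn := w.lam_delta_eval_injective (mul_right_cancel₀ hlead h2)
  apply hlead
  rw [← hn, hg, coeff_sub, coeff_C_mul, poly_coeff_self, mul_one, sub_self]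

/-- A polynomial of degree at most `n` is a combination of the first eigenpolynomials. -/
theorem exists_eq_sum_poly (w : Classical) (n : ℕ) (f : ℂ[X]) (hf : f.degree < n) :
    ∃ c : ℕ → ℂ, f = ∑ k ∈ Finset.range n, C (c k) * w.poly k := by
  induction n generalizing f with
  | zero => exact ⟨0, by simpa using hf⟩
  | succ n ih =>
    have hfn : f.degree ≤ n := by
      rw [degree_le_iff_coeff_zero]
      intro m hm
      exact (degree_lt_iff_coeff_zero _ _).1 hf m (by exact_mod_cast hm)
    obtain ⟨c, hc⟩ := ih (f - C (f.coeff n) * w.poly n) (by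
      apply degree_lt_of_coeff_eq_zero
      · refine (degree_sub_le _ _).trans (max_le hfn ?_)
        rw [← smul_eq_C_mul]
        exact (degree_smul_le _ _).trans (w.poly_degree_le n)
      · rw [coeff_sub, coeff_C_mul, poly_coeff_self, mul_one, sub_self])
    refine ⟨Function.update c n (f.coeff n), ?_⟩
    rw [Finset.sum_range_succ, Function.update_self]
    rw [Finset.sum_congr rfl (g := fun k => C (c k) * w.poly k), ← hc]
    · ring
    · intro k hk
      rw [Function.update_of_ne (Finset.mem_range.1 hk).ne]

/-- Two operators agreeing on the eigenpolynomials agree. -/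
theorem hom_ext (w : Classical) {L M : ℂ[X] →ₗ[ℂ] ℂ[X]}
    (h : ∀ n, L (w.poly n) = M (w.poly n)) : L = M := by
  refine LinearMap.ext fun f => ?_
  obtain ⟨c, hc⟩ := w.exists_eq_sum_poly (f.natDegree + 1) f
    (degree_le_natDegree.trans_lt (by exact_mod_cast Nat.lt_succ_self _))
  rw [hc, map_sum, map_sum]
  refine Finset.sum_congr rfl fun k _ => ?_
  rw [← smul_eq_C_mul, map_smul, map_smul, h]

/-! ### Operators carrying eigenpolynomials to eigenpolynomials -/

/-- `D` maps the monic orthogonal polynomials of `w` to those of `w'`, with factors `l(n)`. -/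
def Maps (w w' : Classical) (D : DiffOp (Fin 1) (Fin 1)) (l : ℂ[X]) : Prop :=
  ∀ n : ℕ, app D (w.poly n) = C (l.eval (n : ℂ)) * w'.poly n

/-- X^n is a combination of the eigenpolynomials of index at most n, whose images again have degree
at most n. -/
theorem degree_of_mapsTo {w w' : Classical} {D : DiffOp (Fin 1) (Fin 1)}
    {c : ℕ → ℂ} (h : ∀ n : ℕ, app D (w.poly n) = C (c n) * w'.poly n) (j : ℕ) :
    (D j 0 0).degree ≤ j := by
  refine degree_coeff_le_of_degree_app_le (fun n => ?_) j
  obtain ⟨d, hd⟩ := w.exists_eq_sum_poly (n + 1) (X ^ n)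
    ((degree_X_pow_le n).trans_lt (by exact_mod_cast Nat.lt_succ_self _))
  rw [hd, map_sum]
  refine (degree_sum_le _ _).trans (Finset.sup_le fun k hk => ?_)
  rw [app_C_mul, h, ← smul_eq_C_mul, ← smul_eq_C_mul]
  refine (degree_smul_le _ _).trans ((degree_smul_le _ _).trans ((w'.poly_degree_le k).trans ?_))
  exact_mod_cast Nat.lt_succ_iff.1 (Finset.mem_range.1 hk)

/-- The factors are the values of `Λ(D)`. -/
theorem eq_lam_of_mapsTo {w w' : Classical} {D : DiffOp (Fin 1) (Fin 1)}
    {c : ℕ → ℂ} (h : ∀ n : ℕ, app D (w.poly n) = C (c n) * w'.poly n) (n : ℕ) :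
    c n = (lam D).eval (n : ℂ) := by
  have := (coeff_app (degree_of_mapsTo h) (w.poly_degree_le n)).2
  rwa [h, coeff_C_mul, poly_coeff_self, poly_coeff_self, mul_one, mul_one] at this

theorem Maps.lam_eq {w w' : Classical} {D : DiffOp (Fin 1) (Fin 1)} {l : ℂ[X]}
    (h : Maps w w' D l) : lam D = l :=
  eq_of_eval_natCast fun n => (eq_lam_of_mapsTo h n).symm

theorem Maps.comp {w w' w'' : Classical} {D E : DiffOp (Fin 1) (Fin 1)} {l m : ℂ[X]}
    (hD : Maps w w' D l) (hE : Maps w' w'' E m) : Maps w w'' (MOP.comp D E) (l * m) := by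
  intro n
  rw [app_comp, hD, app_C_mul, hE, eval_mul, C_mul, mul_assoc]

theorem Maps.add {w w' : Classical} {D E : DiffOp (Fin 1) (Fin 1)} {l m : ℂ[X]}
    (hD : Maps w w' D l) (hE : Maps w w' E m) : Maps w w' (D + E) (l + m) := by
  intro n
  rw [app_add_op, hD, hE, eval_add, C_add, add_mul]

theorem maps_zero (w w' : Classical) : Maps w w' 0 0 := fun n => by simp

theorem maps_C (w : Classical) (c : ℂ) : Maps w w (sop 0 (C c)) (C c) := fun n => by
  simp [mul_comm]

theorem maps_delta (w : Classical) : Maps w w w.delta (lam w.delta) := w.app_delta_poly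

/-- Sums and compositions of δ and constants realize every polynomial in the eigenvalue of δ. -/
theorem exists_maps_of_mem_eigAlg (w : Classical) {a : ℂ[X]} (ha : a ∈ w.eigAlg) :
    ∃ D, Maps w w D a := by
  induction ha using Algebra.adjoin_induction with
  | mem x hx => exact ⟨w.delta, by rw [Set.mem_singleton_iff.1 hx]; exact w.maps_delta⟩
  | algebraMap r => exact ⟨_, w.maps_C r⟩
  | add x y _ _ hx hy =>
    obtain ⟨D, hD⟩ := hx
    obtain ⟨E, hE⟩ := hy
    exact ⟨_, hD.add hE⟩
  | mul x y _ _ hx hy =>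
    obtain ⟨D, hD⟩ := hx
    obtain ⟨E, hE⟩ := hy
    exact ⟨_, hD.comp hE⟩

/-! ### Ladder operators shifting the parameters -/

/-- An operator intertwining the second-order operators maps eigenpolynomials to
eigenpolynomials. -/
theorem maps_of_intertwines {w w' : Classical} {D : DiffOp (Fin 1) (Fin 1)} {l : ℂ[X]}
    (hlam : lam w'.delta = lam w.delta)
    (hD : ∀ f, app w'.delta (app D f) = app D (app w.delta f))
    (hl : ∀ n : ℕ, (app D (w.poly n)).coeff n = l.eval (n : ℂ)) : Maps w w' D l := by
  intro n
  rw [← hl]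
  apply eq_C_mul_poly
  rw [hD, app_delta_poly, app_C_mul, hlam]

theorem poly_coeff_succ (w : Classical) (n : ℕ) : (w.poly n).coeff (n + 1) = 0 :=
  coeff_eq_zero_of_degree_lt ((w.poly_degree_le n).trans_lt (by exact_mod_cast Nat.lt_succ_self n))

/-- The derivative lowers the degree, so only the term of order zero contributes to the leading
coefficient, which stays 1. -/
theorem maps_laguerre_raise (α α' : ℝ) (hα : -1 < α) (hα' : -1 < α') (h : α' = α + 1) :
    Maps (laguerre α hα) (laguerre α' hα') (sop 1 (-1) + sop 0 1) 1 := by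
  subst h
  refine maps_of_intertwines (by simp only [lam_delta_laguerre]) (fun f => ?_) fun n => ?_
  · simp only [app_delta, app_add_op, app_sop, sigma, tau]
    simp
    ring
  · simp [coeff_derivative, poly_coeff_succ, poly_coeff_self]

theorem maps_laguerre_lower (α α' : ℝ) (hα : -1 < α) (hα' : -1 < α') (h : α = α' + 1) :
    Maps (laguerre α hα) (laguerre α' hα') (sop 1 X + sop 0 (C ((α : ℂ))))
      (X + C (α : ℂ)) := by
  subst h
  refine maps_of_intertwines (by simp only [lam_delta_laguerre]) (fun f => ?_) fun n => ?_
  · simp only [app_delta, app_add_op, app_sop, sigma, tau]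
    simp
    ring
  · rw [app_add_op, app_sop, app_sop, coeff_add, Function.iterate_zero, id, coeff_mul_C,
      poly_coeff_self, Function.iterate_one]
    cases n with
    | zero => simp
    | succ n => simp [coeff_derivative, poly_coeff_self]

/-- Raising α while lowering β keeps α + β, hence the eigenvalues; this is what allows an
intertwiner. -/
theorem maps_jacobi_raise (α β α' β' : ℝ) (hα : -1 < α) (hβ : -1 < β) (hα' : -1 < α')
    (hβ' : -1 < β') (h : α' = α + 1) (h' : β = β' + 1) :
    Maps (jacobi α β hα hβ) (jacobi α' β' hα' hβ') (sop 1 (1 + X) + sop 0 (C (β : ℂ)))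
      (X + C (β : ℂ)) := by
  subst h h'
  refine maps_of_intertwines ?_ (fun f => ?_) fun n => ?_
  · simp only [lam_delta_jacobi]
    simp
    ring
  · have h2 : C (2 : ℂ) = 2 := map_ofNat C 2
    simp only [app_delta, app_add_op, app_sop, sigma, tau]
    simp [h2]
    ring
  · rw [app_add_op, app_sop, app_sop, coeff_add, Function.iterate_zero, id, coeff_mul_C,
      poly_coeff_self, Function.iterate_one, mul_add, coeff_add, mul_one, coeff_derivative,
      poly_coeff_succ]
    cases n with
    | zero => simp
    | succ n => simp [coeff_derivative, poly_coeff_self]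

theorem maps_jacobi_lower (α β α' β' : ℝ) (hα : -1 < α) (hβ : -1 < β) (hα' : -1 < α')
    (hβ' : -1 < β') (h : α = α' + 1) (h' : β' = β + 1) :
    Maps (jacobi α β hα hβ) (jacobi α' β' hα' hβ') (sop 1 (X - 1) + sop 0 (C (α : ℂ)))
      (X + C (α : ℂ)) := by
  subst h h'
  refine maps_of_intertwines ?_ (fun f => ?_) fun n => ?_
  · simp only [lam_delta_jacobi]
    simp
    ring
  · have h2 : C (2 : ℂ) = 2 := map_ofNat C 2
    simp only [app_delta, app_add_op, app_sop, sigma, tau]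
    simp [h2]
    ring
  · rw [app_add_op, app_sop, app_sop, coeff_add, Function.iterate_zero, id, coeff_mul_C,
      poly_coeff_self, Function.iterate_one, mul_sub, coeff_sub, mul_one, coeff_derivative,
      poly_coeff_succ]
    cases n with
    | zero => simp
    | succ n => simp [coeff_derivative, poly_coeff_self]

/-- `(X + c + 1) ⋯ (X + c + k)` -/
def risingShift (c : ℝ) (k : ℕ) : ℂ[X] := ∏ i ∈ Finset.range k, (X + C ((c : ℂ) + (i + 1 : ℕ)))

theorem risingShift_succ (c : ℝ) (k : ℕ) :
    risingShift c (k + 1) = (X + C ((c : ℂ) + (k + 1 : ℕ))) * risingShift c k := by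
  rw [risingShift, Finset.prod_range_succ, mul_comm, risingShift]

theorem eval_risingShift (c : ℝ) (hc : -1 < c) (k n : ℕ) :
    (risingShift c k).eval (n : ℂ) =
      ((Real.Gamma (n + c + k + 1) / Real.Gamma (n + c + 1) : ℝ) : ℂ) := by
  have hpos (m : ℕ) : 0 < (n : ℝ) + c + m + 1 := by
    have : (0 : ℝ) ≤ n + m := by positivity
    linarith
  induction k with
  | zero =>
    have := (Real.Gamma_pos_of_pos (hpos 0)).ne'
    simp only [Nat.cast_zero, add_zero] at this ⊢
    simp [risingShift, div_self this]
  | succ k ih =>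
    rw [risingShift_succ, eval_mul, ih]
    have : (n : ℝ) + c + (k + 1 : ℕ) + 1 = (n + c + k + 1) + 1 := by push_cast; ring
    rw [this, Real.Gamma_add_one (hpos k).ne']
    simp
    ring

theorem eval_risingShift_ne_zero (c : ℝ) (hc : -1 < c) (k n : ℕ) :
    (risingShift c k).eval (n : ℂ) ≠ 0 := by
  rw [risingShift, eval_prod]
  refine Finset.prod_ne_zero_iff.2 fun i _ => ?_
  simp only [eval_add, eval_X, eval_C]
  have : (0 : ℝ) < n + (c + (i + 1 : ℕ)) := by
    have : (0 : ℝ) ≤ n + i := by positivity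
    push_cast
    linarith
  exact_mod_cast this.ne'

theorem maps_oneSubPow (k : ℕ) (α α' : ℝ) (hα : -1 < α) (hα' : -1 < α') (h : α' = α + k) :
    Maps (laguerre α hα) (laguerre α' hα') (oneSubPow k) 1 := by
  induction k generalizing α with
  | zero =>
    obtain rfl : α' = α := by simpa using h
    exact maps_C _ 1
  | succ k ih =>
    push_cast at h
    rw [← one_mul (1 : ℂ[X])]
    exact (maps_laguerre_raise α (α + 1) hα (by linarith) rfl).comp
      (ih (α + 1) (by linarith) (by linarith))

/-- The constants in the product count up from the target parameter, so the factor applied first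
carries the source parameter. The induction therefore moves the source and keeps the target. -/
theorem maps_shiftProd_laguerre (k : ℕ) (α α' : ℝ) (hα : -1 < α) (hα' : -1 < α')
    (h : α = α' + k) :
    Maps (laguerre α hα) (laguerre α' hα') (shiftProd X α' k) (risingShift α' k) := by
  induction k generalizing α with
  | zero =>
    obtain rfl : α = α' := by simpa using h
    simpa [shiftProd, risingShift] using maps_C (laguerre α hα) 1
  | succ k ih =>
    have hk : (0 : ℝ) ≤ k := by positivity
    rw [risingShift_succ, shiftProd]
    push_cast at h
    have := (maps_laguerre_lower α (α' + k) hα (by linarith) (by linarith)).comp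
      (ih (α' + k) (by linarith) rfl)
    convert this using 4 <;> simp [h]

theorem maps_shiftProd_jacobi_raise (k : ℕ) (α β α' β' : ℝ) (hα : -1 < α) (hβ : -1 < β)
    (hα' : -1 < α') (hβ' : -1 < β') (h : α' = α + k) (h' : β = β' + k) :
    Maps (jacobi α β hα hβ) (jacobi α' β' hα' hβ') (shiftProd (1 + X) β' k)
      (risingShift β' k) := by
  induction k generalizing α β with
  | zero =>
    obtain rfl : α' = α := by simpa using h
    obtain rfl : β = β' := by simpa using h'
    simpa [shiftProd, risingShift] using maps_C (jacobi _ _ hα hβ) 1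
  | succ k ih =>
    have hk : (0 : ℝ) ≤ k := by positivity
    rw [risingShift_succ, shiftProd]
    push_cast at h h'
    have := (maps_jacobi_raise α β (α + 1) (β' + k) hα hβ (by linarith) (by linarith) rfl
      (by linarith)).comp (ih (α + 1) (β' + k) (by linarith) (by linarith) (by linarith) rfl)
    convert this using 4 <;> simp [h']

theorem maps_shiftProd_jacobi_lower (k : ℕ) (α β α' β' : ℝ) (hα : -1 < α) (hβ : -1 < β)
    (hα' : -1 < α') (hβ' : -1 < β') (h : α = α' + k) (h' : β' = β + k) :
    Maps (jacobi α β hα hβ) (jacobi α' β' hα' hβ') (shiftProd (X - 1) α' k)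
      (risingShift α' k) := by
  induction k generalizing α β with
  | zero =>
    obtain rfl : α = α' := by simpa using h
    obtain rfl : β' = β := by simpa using h'
    simpa [shiftProd, risingShift] using maps_C (jacobi _ _ hα hβ) 1
  | succ k ih =>
    have hk : (0 : ℝ) ≤ k := by positivity
    rw [risingShift_succ, shiftProd]
    push_cast at h h'
    have := (maps_jacobi_lower α β (α' + k) (β + 1) hα hβ (by linarith) (by linarith)
      (by linarith) rfl).comp
      (ih (α' + k) (β + 1) (by linarith) (by linarith) rfl (by linarith))
    convert this using 4 <;> simp [h]

end Classical

/-! ### Moment functionals and orthogonality -/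

namespace Classical

open MeasureTheory

theorem density_pos (w : Classical) {x : ℝ} (hx : x ∈ w.interval) : 0 < w.density x := by
  cases w with
  | hermite b => exact Real.exp_pos _
  | laguerre α hα => exact mul_pos (Real.exp_pos _) (Real.rpow_pos_of_pos hx _)
  | jacobi α β hα hβ =>
    obtain ⟨h1, h2⟩ := hx
    exact mul_pos (Real.rpow_pos_of_pos (by linarith) _) (Real.rpow_pos_of_pos (by linarith) _)

theorem isOpen_interval (w : Classical) : IsOpen w.interval := by
  cases w
  exacts [isOpen_univ, isOpen_Ioi, isOpen_Ioo]

theorem interval_nonempty (w : Classical) : w.interval.Nonempty := by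
  cases w
  exacts [⟨0, trivial⟩, ⟨1, one_pos (α := ℝ)⟩, ⟨0, by constructor <;> norm_num⟩]

theorem continuous_eval_ofReal (f : ℂ[X]) : Continuous fun x : ℝ => f.eval (x : ℂ) :=
  f.continuous.comp Complex.continuous_ofReal

theorem integrable_pow_mul_hermite (b : ℝ) (k : ℕ) :
    Integrable fun x : ℝ => x ^ k * Real.exp (-x ^ 2 + 2 * b * x) := by
  -- Since (x - 2b)² ≥ 0, one has -x² + 2bx ≤ 2b² - x²/2, which gives a Gaussian majorant.
  have h := (integrable_rpow_mul_exp_neg_mul_sq (b := 1 / 2) (by norm_num) (s := k)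
    (by have : (0 : ℝ) ≤ k := by positivity
        linarith)).const_mul (Real.exp (2 * b ^ 2))
  refine h.mono (by fun_prop) (Filter.Eventually.of_forall fun x => ?_)
  rw [Real.rpow_natCast, mul_left_comm, norm_mul, norm_mul, ← Real.exp_add]
  refine mul_le_mul_of_nonneg_left ?_ (norm_nonneg _)
  rw [Real.norm_of_nonneg (Real.exp_pos _).le, Real.norm_of_nonneg (Real.exp_pos _).le]
  apply Real.exp_le_exp.2
  nlinarith [sq_nonneg (x - 2 * b)]

theorem integrableOn_pow_mul_laguerre (α : ℝ) (hα : -1 < α) (k : ℕ) :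
    IntegrableOn (fun x : ℝ => x ^ k * (Real.exp (-x) * x ^ α)) (Set.Ioi 0) := by
  have hk : (0 : ℝ) ≤ k := by positivity
  refine (Real.GammaIntegral_convergent (s := k + α + 1) (by linarith)).congr_fun
    (fun x hx => ?_) measurableSet_Ioi
  have hx' : (0 : ℝ) < x := hx
  simp only
  rw [show (k : ℝ) + α + 1 - 1 = k + α by ring, Real.rpow_add hx', Real.rpow_natCast]
  ring

/-- Each factor can be singular at one endpoint only; on each half of the interval the other factor
is continuous. -/
theorem intervalIntegrable_jacobi (α β : ℝ) (hα : -1 < α) (hβ : -1 < β) :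
    IntervalIntegrable (fun x : ℝ => (1 - x) ^ α * (1 + x) ^ β) volume (-1) 1 := by
  refine IntervalIntegrable.trans (b := 0) ?_ ?_
  · have h : IntervalIntegrable (fun x : ℝ => (1 + x) ^ β) volume (0 - 1) (1 - 1) :=
      (intervalIntegral.intervalIntegrable_rpow' (a := 0) (b := 1) hβ).comp_add_left 1
    simp only [zero_sub, sub_self] at h
    refine h.continuousOn_mul (ContinuousOn.rpow_const (by fun_prop) fun x hx => Or.inl ?_)
    rw [Set.uIcc_of_le (by norm_num)] at hx
    linarith [hx.2]
  · have h : IntervalIntegrable (fun x : ℝ => (1 - x) ^ α) volume (1 - 1) (1 - 0) :=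
      (intervalIntegral.intervalIntegrable_rpow' (a := 1) (b := 0) hα).comp_sub_left 1
    simp only [sub_zero, sub_self] at h
    refine h.mul_continuousOn (ContinuousOn.rpow_const (by fun_prop) fun x hx => Or.inl ?_)
    rw [Set.uIcc_of_le (by norm_num)] at hx
    linarith [hx.1]

/-- Polynomials are integrable against classical weights. -/
theorem integrableOn_eval_mul (w : Classical) (f : ℂ[X]) :
    IntegrableOn (fun x : ℝ => f.eval (x : ℂ) * (w.density x : ℂ)) w.interval := by
  have of_pow (h : ∀ k : ℕ, IntegrableOn (fun x : ℝ => x ^ k * w.density x) w.interval) :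
      IntegrableOn (fun x : ℝ => f.eval (x : ℂ) * (w.density x : ℂ)) w.interval := by
    induction f using Polynomial.induction_on' with
    | add p q hp hq =>
      simp only [eval_add, add_mul]
      exact hp.add hq
    | monomial k c =>
      have := ((h k).ofReal (𝕜 := ℂ)).const_mul c
      refine this.congr (Filter.Eventually.of_forall fun x => ?_)
      simp [mul_assoc]
  cases w with
  | hermite b =>
    refine of_pow fun k => ?_
    simp only [interval, density, integrableOn_univ]
    exact integrable_pow_mul_hermite b k
  | laguerre α hα => exact of_pow fun k => integrableOn_pow_mul_laguerre α hα k
  | jacobi α β hα hβ =>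
    have h := (intervalIntegrable_jacobi α β hα hβ)
    have h' : IntervalIntegrable (fun x => ((jacobi α β hα hβ).density x : ℂ)) volume (-1) 1 :=
      ⟨h.1.ofReal (𝕜 := ℂ), h.2.ofReal (𝕜 := ℂ)⟩
    exact (intervalIntegrable_iff_integrableOn_Ioo_of_le (by norm_num)).1
      (h'.continuousOn_mul (continuous_eval_ofReal f).continuousOn)

/-- The moment functional `f ↦ ∫ f w`. -/
def functional (w : Classical) : ℂ[X] →ₗ[ℂ] ℂ where
  toFun f := ∫ x in w.interval, f.eval (x : ℂ) * (w.density x : ℂ)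
  map_add' f g := by
    simp only [eval_add, add_mul]
    exact integral_add (w.integrableOn_eval_mul f) (w.integrableOn_eval_mul g)
  map_smul' c f := by
    simp only [eval_smul, smul_eq_mul, mul_assoc, RingHom.id_apply]
    exact integral_const_mul _ _

theorem functional_apply (w : Classical) (f : ℂ[X]) :
    w.functional f = ∫ x in w.interval, f.eval (x : ℂ) * (w.density x : ℂ) := rfl

theorem hasDerivAt_eval_ofReal (f : ℂ[X]) (x : ℝ) :
    HasDerivAt (fun y : ℝ => f.eval (y : ℂ)) ((derivative f).eval (x : ℂ)) x :=
  (f.hasDerivAt (x : ℂ)).comp_ofReal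

/-- The Pearson equation `(σ w)' = τ w`, integrated against a polynomial. -/
theorem functional_pearson (w : Classical) (f : ℂ[X]) :
    w.functional (derivative f * w.sigma + f * w.tau) = 0 := by
  have hint := w.integrableOn_eval_mul (derivative f * w.sigma + f * w.tau)
  rw [functional_apply]
  cases w with
  | hermite b =>
    have hg := (hermite b).integrableOn_eval_mul f
    simp only [interval, integrableOn_univ, setIntegral_univ] at hint hg ⊢
    refine integral_eq_zero_of_hasDerivAt_of_integrable (fun x => ?_) hint hg
    have h1 : HasDerivAt (hermite b).density
        (Real.exp (-x ^ 2 + 2 * b * x) * (-(2 * x) + 2 * b)) x := by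
      have h : HasDerivAt (fun y : ℝ => -y ^ 2 + 2 * b * y) (-(2 * x) + 2 * b) x := by
        exact (((hasDerivAt_pow 2 x).neg).add ((hasDerivAt_id x).const_mul (2 * b))).congr_deriv
          (by simp)
      exact h.exp
    refine ((hasDerivAt_eval_ofReal f x).mul h1.ofReal_comp).congr_deriv ?_
    simp only [density, sigma, tau]
    simp
    ring
  | laguerre α hα =>
    have hg := (laguerre α hα).integrableOn_eval_mul (f * X)
    simp only [interval] at hint hg ⊢
    -- This is f σ w with x · x^α merged into x^(α+1): as α + 1 > 0, it is continuous up to 0 and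
    -- vanishes there, so there is no boundary term.
    set g : ℝ → ℂ := fun x => f.eval (x : ℂ) * ((Real.exp (-x) * x ^ (α + 1) : ℝ) : ℂ) with hgdef
    have hgint : IntegrableOn g (Set.Ioi 0) := by
      refine hg.congr_fun (fun x hx => ?_) measurableSet_Ioi
      have hx' : (0 : ℝ) < x := hx
      simp only [hgdef, density, Real.rpow_add hx', Real.rpow_one]
      simp
      ring
    have hderiv : ∀ x ∈ Set.Ioi (0 : ℝ), HasDerivAt g
        ((derivative f * (laguerre α hα).sigma + f * (laguerre α hα).tau).eval (x : ℂ) *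
          ((laguerre α hα).density x : ℂ)) x := by
      intro x hx
      have hx' : (0 : ℝ) < x := hx
      have h1 : HasDerivAt (fun y : ℝ => Real.exp (-y) * y ^ (α + 1))
          (Real.exp (-x) * -1 * x ^ (α + 1) + Real.exp (-x) * (1 * (α + 1) * x ^ (α + 1 - 1))) x :=
        ((hasDerivAt_id x).neg.exp).mul ((hasDerivAt_id x).rpow_const (Or.inl hx'.ne'))
      refine ((hasDerivAt_eval_ofReal f x).mul h1.ofReal_comp).congr_deriv ?_
      simp only [density, sigma, tau, Real.rpow_add hx', Real.rpow_one, add_sub_cancel_right]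
      simp
      ring
    have hcont : ContinuousWithinAt g (Set.Ici 0) 0 := by
      refine Continuous.continuousWithinAt ?_
      refine (continuous_eval_ofReal f).mul (Complex.continuous_ofReal.comp ?_)
      exact (Real.continuous_exp.comp continuous_neg).mul
        (Real.continuous_rpow_const (by linarith))
    have h := integral_Ioi_of_hasDerivAt_of_tendsto hcont hderiv hint
      (tendsto_zero_of_hasDerivAt_of_integrableOn_Ioi hderiv hint hgint)
    rw [h, hgdef]
    simp [Real.zero_rpow (by linarith : α + 1 ≠ 0)]
  | jacobi α β hα hβ =>
    simp only [interval] at hint ⊢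
    set g : ℝ → ℂ := fun x => f.eval (x : ℂ) *
      (((1 - x) ^ (α + 1) * (1 + x) ^ (β + 1) : ℝ) : ℂ) with hgdef
    rw [← integral_Ioc_eq_integral_Ioo, ← intervalIntegral.integral_of_le (by norm_num)]
    rw [intervalIntegral.integral_eq_sub_of_hasDerivAt_of_le (f := g) (by norm_num)]
    · simp [hgdef, Real.zero_rpow (by linarith : α + 1 ≠ 0),
        Real.zero_rpow (by linarith : β + 1 ≠ 0)]
    · refine Continuous.continuousOn ?_
      refine (continuous_eval_ofReal f).mul (Complex.continuous_ofReal.comp ?_)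
      exact ((Real.continuous_rpow_const (by linarith)).comp (by fun_prop)).mul
        ((Real.continuous_rpow_const (by linarith)).comp (by fun_prop))
    · rintro x ⟨hx1, hx2⟩
      have h1' : 0 < 1 - x := by linarith
      have h2' : 0 < 1 + x := by linarith
      have h1 := (((hasDerivAt_id x).const_sub 1).rpow_const (p := α + 1) (Or.inl h1'.ne')).mul
        (((hasDerivAt_id x).const_add 1).rpow_const (p := β + 1) (Or.inl h2'.ne'))
      refine ((hasDerivAt_eval_ofReal f x).mul h1.ofReal_comp).congr_deriv ?_
      have e1 : (1 - x) ^ (α + 1) = (1 - x) ^ α * (1 - x) := by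
        rw [Real.rpow_add h1', Real.rpow_one]
      have e2 : (1 + x) ^ (β + 1) = (1 + x) ^ β * (1 + x) := by
        rw [Real.rpow_add h2', Real.rpow_one]
      have h2 : C (2 : ℂ) = 2 := map_ofNat C 2
      simp only [density, sigma, tau, add_sub_cancel_right]
      simp [h2, e1, e2]
      ring
    · exact (intervalIntegrable_iff_integrableOn_Ioo_of_le (by norm_num)).2 hint

/-- The second-order operator is symmetric. -/
theorem functional_delta_mul (w : Classical) (f g : ℂ[X]) :
    w.functional (app w.delta f * g) = w.functional (f * app w.delta g) := by
  -- The Wronskian-type expression f'g - fg' turns the Pearson identity into Green's formula: the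
  -- integrand becomes (δf) g - f (δg).
  have h := w.functional_pearson (derivative f * g - f * derivative g)
  rw [← sub_eq_zero, ← map_sub, ← h]
  congr 1
  rw [app_delta, app_delta]
  simp only [map_sub, derivative_mul]
  ring

theorem functional_poly_mul_poly (w : Classical) {m n : ℕ} (h : m ≠ n) :
    w.functional (w.poly m * w.poly n) = 0 := by
  have e := w.functional_delta_mul (w.poly m) (w.poly n)
  rw [app_delta_poly, app_delta_poly, mul_assoc, mul_left_comm (w.poly m), ← smul_eq_C_mul,
    ← smul_eq_C_mul, map_smul, map_smul, smul_eq_mul, smul_eq_mul, ← sub_eq_zero, ← sub_mul] at e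
  refine (mul_eq_zero.1 e).resolve_left fun h0 => h ?_
  exact w.lam_delta_eval_injective (sub_eq_zero.1 h0)

/-- Complex conjugation of the coefficients. -/
abbrev conj (f : ℂ[X]) : ℂ[X] := f.map (starRingEnd ℂ)

theorem eval_conj (f : ℂ[X]) (x : ℝ) : (conj f).eval (x : ℂ) = star (f.eval (x : ℂ)) := by
  have := Polynomial.eval_map_apply (f := starRingEnd ℂ) (p := f) (x : ℂ)
  rw [Complex.conj_ofReal] at this
  exact this

/-- σ, τ and the eigenvalue are real, so the conjugate is an eigenpolynomial for the same
eigenvalue, and a monic one is unique. -/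
theorem conj_poly (w : Classical) (n : ℕ) : conj (w.poly n) = w.poly n := by
  have hs : conj w.sigma = w.sigma := by cases w <;> simp [conj, sigma]
  have h2 : starRingEnd ℂ 2 = 2 := map_ofNat _ 2
  have ht : conj w.tau = w.tau := by
    cases w <;> simp [conj, tau, h2]
  have hm : starRingEnd ℂ ((lam w.delta).eval (n : ℂ)) = (lam w.delta).eval (n : ℂ) := by
    cases w <;> simp [lam_delta_hermite, lam_delta_laguerre, lam_delta_jacobi, h2]
  have h : app w.delta (conj (w.poly n)) =
      C ((lam w.delta).eval (n : ℂ)) * conj (w.poly n) := by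
    have e := congrArg conj (w.app_delta_poly n)
    rw [app_delta] at e ⊢
    simp only [conj, Polynomial.map_add, Polynomial.map_mul, ← derivative_map, map_C] at e hs ht
    rw [hs, ht, hm] at e
    exact e
  rw [w.eq_C_mul_poly h, coeff_map, poly_coeff_self]
  simp

/-- The integrand is |f|² w, positive on the interval except at the finitely many zeros of f. -/
theorem functional_mul_conj_ne_zero (w : Classical) {f : ℂ[X]} (hf : f ≠ 0) :
    w.functional (f * conj f) ≠ 0 := by
  have e (x : ℝ) : (f * conj f).eval (x : ℂ) * (w.density x : ℂ) =
      ((Complex.normSq (f.eval (x : ℂ)) * w.density x : ℝ) : ℂ) := by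
    rw [eval_mul, eval_conj, Complex.ofReal_mul, ← Complex.mul_conj]
    rfl
  have hint : IntegrableOn (fun x : ℝ => Complex.normSq (f.eval (x : ℂ)) * w.density x)
      w.interval := by
    have := (w.integrableOn_eval_mul (f * conj f)).re
    simp only [e] at this
    exact this
  have hpos : 0 < ∫ x in w.interval, Complex.normSq (f.eval (x : ℂ)) * w.density x := by
    have hm := w.isOpen_interval.measurableSet
    rw [setIntegral_pos_iff_support_of_nonneg_ae _ hint]
    · have hfin : Set.Finite {x : ℝ | f.eval (x : ℂ) = 0} := by
        refine ((f.rootSet_finite ℂ).preimage Complex.ofReal_injective.injOn).subset fun x hx => ?_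
        rw [Set.mem_preimage, mem_rootSet]
        exact ⟨hf, by simpa using hx⟩
      have hsub : w.interval \ {x : ℝ | f.eval (x : ℂ) = 0} ⊆
          Function.support (fun x : ℝ => Complex.normSq (f.eval (x : ℂ)) * w.density x) ∩
            w.interval := by
        rintro x ⟨hx, hx0⟩
        refine ⟨mul_ne_zero ?_ (w.density_pos hx).ne', hx⟩
        simpa using hx0
      refine lt_of_lt_of_le ?_ (measure_mono hsub)
      rw [measure_sdiff_null (hfin.measure_zero _)]
      exact w.isOpen_interval.measure_pos _ w.interval_nonempty
    · filter_upwards [ae_restrict_mem hm] with x hx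
      exact mul_nonneg (Complex.normSq_nonneg _) (w.density_pos hx).le
  rw [functional_apply]
  simp only [e]
  rw [integral_complex_ofReal]
  exact_mod_cast hpos.ne'

theorem functional_poly_mul_self_ne_zero (w : Classical) (n : ℕ) :
    w.functional (w.poly n * w.poly n) ≠ 0 := by
  have := w.functional_mul_conj_ne_zero (w.poly_ne_zero n)
  rwa [conj_poly] at this

/-- A polynomial of degree at most `n` orthogonal to the lower degrees is a multiple of the
orthogonal polynomial. -/
theorem eq_C_mul_poly_of_orthogonal (w : Classical) {n : ℕ} {f : ℂ[X]} (hf : f.degree ≤ n)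
    (h : ∀ k < n, w.functional (f * w.poly k) = 0) : f = C (f.coeff n) * w.poly n := by
  obtain ⟨c, hc⟩ := w.exists_eq_sum_poly (n + 1) f
    (hf.trans_lt (by exact_mod_cast Nat.lt_succ_self _))
  have hk : ∀ k < n, c k = 0 := by
    intro k hk
    have := h k hk
    rw [hc, Finset.sum_mul, map_sum, Finset.sum_eq_single_of_mem k
      (Finset.mem_range.2 (by omega))] at this
    · rw [mul_assoc, ← smul_eq_C_mul, map_smul, smul_eq_mul] at this
      exact (mul_eq_zero.1 this).resolve_right (w.functional_poly_mul_self_ne_zero k)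
    · intro l _ hl
      rw [mul_assoc, ← smul_eq_C_mul, map_smul, functional_poly_mul_poly _ hl, smul_zero]
  rw [Finset.sum_range_succ, Finset.sum_eq_zero (fun k hk' => by
    rw [hk k (Finset.mem_range.1 hk')]; simp), zero_add] at hc
  have : f.coeff n = c n := by
    rw [hc, coeff_C_mul, poly_coeff_self, mul_one]
  rw [this, hc]

end Classical

/-! ### Evaluation at singular points -/

namespace Classical

/-- `x₀` is a regular singular point of the second-order operator with exponent `e`: at `x₀`, the
Taylor coefficients of its eigenpolynomials satisfy a two-term recursion. -/
structure IsSingularPoint (w : Classical) (x₀ s : ℂ) (e : ℝ) : Prop where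
  ne_zero : s ≠ 0
  lt : -1 < e
  recursion : ∀ (f : ℂ[X]) (μ : ℂ), app w.delta f = C μ * f → ∀ j : ℕ,
    (j + 1) * (s * (j + e + 1)) * (taylor x₀ f).coeff (j + 1) =
      (μ - (lam w.delta).eval (j : ℂ)) * (taylor x₀ f).coeff j

theorem taylor_derivative (x₀ : ℂ) (f : ℂ[X]) :
    taylor x₀ (derivative f) = derivative (taylor x₀ f) := by
  simp [taylor_apply, derivative_comp]

/-- Because σ vanishes at x₀, the coefficient of (x - x₀)^j in δf = μf involves only the Taylor
coefficients j and j + 1 of f. -/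
theorem recursion_of_taylor (w : Classical) (x₀ s₁ s₂ t₀ t₁ : ℂ)
    (hs : taylor x₀ w.sigma = C s₁ * X + C s₂ * X ^ 2) (ht : taylor x₀ w.tau = C t₀ + C t₁ * X)
    (hl : ∀ z : ℂ, (lam w.delta).eval z = z * (z - 1) * s₂ + z * t₁)
    (f : ℂ[X]) (μ : ℂ) (hf : app w.delta f = C μ * f) (j : ℕ) :
    (j + 1) * (j * s₁ + t₀) * (taylor x₀ f).coeff (j + 1) =
      (μ - (lam w.delta).eval (j : ℂ)) * (taylor x₀ f).coeff j := by
  have h := congrArg (fun p => (taylor x₀ p).coeff j) hf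
  simp only [app_delta, map_add, taylor_mul, taylor_derivative, hs, ht, taylor_C,
    coeff_C_mul] at h
  rw [hl]
  set g := taylor x₀ f
  have h1 : derivative (derivative g) * (C s₁ * X + C s₂ * X ^ 2) +
      derivative g * (C t₀ + C t₁ * X) = C s₁ * (derivative (derivative g) * X) +
        C s₂ * (derivative (derivative g) * X ^ 2) + (C t₀ * derivative g +
          C t₁ * (derivative g * X)) := by ring
  rw [h1] at h
  simp only [coeff_add, coeff_C_mul] at h
  match j with
  | 0 =>
    simp [coeff_derivative] at h ⊢
    linear_combination h
  | 1 =>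
    rw [coeff_mul_X, coeff_mul_X_pow'] at h
    simp [coeff_derivative] at h ⊢
    linear_combination h
  | j + 2 =>
    rw [coeff_mul_X, coeff_mul_X_pow, coeff_mul_X] at h
    simp [coeff_derivative] at h ⊢
    linear_combination h

theorem isSingularPoint_laguerre (α : ℝ) (hα : -1 < α) :
    (laguerre α hα).IsSingularPoint 0 1 α where
  ne_zero := one_ne_zero
  lt := hα
  recursion f μ hf j := by
    rw [← recursion_of_taylor (laguerre α hα) 0 1 0 (α + 1) (-1) (by simp [sigma])
      (by simp [tau, sub_eq_add_neg]) (by simp [lam_delta_laguerre]) f μ hf j]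
    ring

theorem isSingularPoint_jacobi_one (α β : ℝ) (hα : -1 < α) (hβ : -1 < β) :
    (jacobi α β hα hβ).IsSingularPoint 1 (-2) α where
  ne_zero := by norm_num
  lt := hα
  recursion f μ hf j := by
    have h2 : C (2 : ℂ) = 2 := map_ofNat C 2
    rw [← recursion_of_taylor (jacobi α β hα hβ) 1 (-2) (-1) (-2 * (α + 1)) (-(α + β + 2))
      (by simp [sigma, taylor_apply, h2]; ring) (by simp [tau, taylor_apply, h2]; ring)
      (by intro z; simp [lam_delta_jacobi]; ring) f μ hf j]
    ring

theorem isSingularPoint_jacobi_neg_one (α β : ℝ) (hα : -1 < α) (hβ : -1 < β) :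
    (jacobi α β hα hβ).IsSingularPoint (-1) 2 β where
  ne_zero := by norm_num
  lt := hβ
  recursion f μ hf j := by
    have h2 : C (2 : ℂ) = 2 := map_ofNat C 2
    rw [← recursion_of_taylor (jacobi α β hα hβ) (-1) 2 (-1) (2 * (β + 1)) (-(α + β + 2))
      (by simp [sigma, taylor_apply, h2]; ring) (by simp [tau, taylor_apply, h2]; ring)
      (by intro z; simp [lam_delta_jacobi]; ring) f μ hf j]
    ring

/-- `(c + 1) ⋯ (c + n)` -/
def rising (c : ℝ) (n : ℕ) : ℂ := ∏ j ∈ Finset.range n, ((j : ℂ) + c + 1)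

theorem natCast_add_ne_zero {c : ℝ} (hc : -1 < c) (j : ℕ) : (j : ℂ) + c + 1 ≠ 0 := by
  have : (0 : ℝ) < j + c + 1 := by
    have : (0 : ℝ) ≤ j := by positivity
    linarith
  exact_mod_cast this.ne'

theorem rising_ne_zero {c : ℝ} (hc : -1 < c) (n : ℕ) : rising c n ≠ 0 :=
  Finset.prod_ne_zero_iff.2 fun j _ => natCast_add_ne_zero hc j

theorem rising_succ (c : ℝ) (n : ℕ) : rising c (n + 1) = rising c n * (n + c + 1) :=
  Finset.prod_range_succ _ _

/-- Both sides are (c+1) ⋯ (c+n+k), split after n factors or after k factors. -/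
theorem rising_mul_risingShift (c : ℝ) (k n : ℕ) :
    rising c n * (risingShift c k).eval (n : ℂ) = rising (c + k) n * rising c k := by
  have h1 : rising c (n + k) = rising c n * (risingShift c k).eval (n : ℂ) := by
    rw [rising, Finset.prod_range_add, rising, risingShift, eval_prod]
    congr 1
    refine Finset.prod_congr rfl fun i _ => ?_
    simp
    ring
  have h2 : rising c (k + n) = rising c k * rising (c + k) n := by
    rw [rising, Finset.prod_range_add, rising, rising]
    congr 1
    refine Finset.prod_congr rfl fun i _ => ?_
    simp
    ring
  rw [← h1, add_comm, h2, mul_comm]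

namespace IsSingularPoint

variable {w w' : Classical} {x₀ s : ℂ} {e e' : ℝ}

/-- The recursion can be solved upwards: its factor (j+1) s (j+e+1) never vanishes because e > -1.
The polynomial S serves all eigenfunctions and all eigenvalues at once. -/
theorem coeff_taylor (h : w.IsSingularPoint x₀ s e) (j : ℕ) : ∃ S : ℂ[X], ∀ (f : ℂ[X]) (μ : ℂ),
    app w.delta f = C μ * f → (taylor x₀ f).coeff j = S.eval μ * f.eval x₀ := by
  induction j with
  | zero => exact ⟨1, fun f μ _ => by simp⟩
  | succ j ih =>
    obtain ⟨S, hS⟩ := ih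
    set d : ℂ := (j + 1) * (s * (j + e + 1)) with hd
    have hd0 : d ≠ 0 := mul_ne_zero (Nat.cast_add_one_ne_zero j)
      (mul_ne_zero h.ne_zero (natCast_add_ne_zero h.lt j))
    refine ⟨C d⁻¹ * (X - C ((lam w.delta).eval (j : ℂ))) * S, fun f μ hf => ?_⟩
    have := h.recursion f μ hf j
    rw [← hd, hS f μ hf] at this
    apply mul_left_cancel₀ hd0
    rw [this]
    simp only [eval_mul, eval_C, eval_sub, eval_X]
    field_simp

/-- At a singular point, the value of `f · D` for an eigenfunction `f` is the value of `f` times a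
polynomial in the eigenvalue. -/
theorem eval_app (h : w.IsSingularPoint x₀ s e) (D : DiffOp (Fin 1) (Fin 1)) :
    ∃ A : ℂ[X], ∀ (f : ℂ[X]) (μ : ℂ), app w.delta f = C μ * f →
      (app D f).eval x₀ = A.eval μ * f.eval x₀ := by
  choose S hS using h.coeff_taylor
  refine ⟨∑ j ∈ D.support, C (j.factorial * (D j 0 0).eval x₀) * S j, fun f μ hf => ?_⟩
  rw [app_apply, Finsupp.sum, eval_finsetSum, eval_finsetSum, Finset.sum_mul]
  refine Finset.sum_congr rfl fun j _ => ?_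
  have h1 := hS j f μ hf
  have h2 : (derivative^[j] f).eval x₀ = j.factorial * (taylor x₀ f).coeff j := by
    rw [taylor_coeff, ← factorial_smul_hasseDeriv]
    simp
  rw [eval_mul, h2, h1]
  simp only [eval_mul, eval_C]
  ring

theorem prod_mul_eval (h : w.IsSingularPoint x₀ s e) {f : ℂ[X]} {μ : ℂ}
    (hf : app w.delta f = C μ * f) (n : ℕ) :
    f.eval x₀ * ∏ j ∈ Finset.range n, (μ - (lam w.delta).eval (j : ℂ)) =
      (∏ j ∈ Finset.range n, (((j : ℂ) + 1) * s)) * rising e n * (taylor x₀ f).coeff n := by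
  induction n with
  | zero => simp [rising]
  | succ n ih =>
    rw [Finset.prod_range_succ, Finset.prod_range_succ, ← mul_assoc, ih, rising_succ]
    linear_combination (-(∏ j ∈ Finset.range n, (((j : ℂ) + 1) * s)) * rising e n) *
      h.recursion f μ hf n

/-- The recursion is run from the value at x₀ up to the n-th Taylor coefficient, which is the
leading coefficient 1. -/
theorem eval_poly (h : w.IsSingularPoint x₀ s e) (n : ℕ) :
    (w.poly n).eval x₀ * ∏ j ∈ Finset.range n,
      ((lam w.delta).eval (n : ℂ) - (lam w.delta).eval (j : ℂ)) =
      (∏ j ∈ Finset.range n, (((j : ℂ) + 1) * s)) * rising e n := by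
  rw [h.prod_mul_eval (w.app_delta_poly n)]
  have hdeg : (w.poly n).natDegree = n := by
    refine le_antisymm (natDegree_le_iff_degree_le.2 (w.poly_degree_le n))
      (le_natDegree_of_ne_zero ?_)
    rw [poly_coeff_self]
    exact one_ne_zero
  have : (taylor x₀ (w.poly n)).coeff n = 1 := by
    have h2 := coeff_taylor_natDegree x₀ (w.poly n)
    rwa [leadingCoeff, hdeg, poly_coeff_self] at h2
  rw [this, mul_one]

theorem eval_poly_ne_zero (h : w.IsSingularPoint x₀ s e) (n : ℕ) : (w.poly n).eval x₀ ≠ 0 := by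
  refine left_ne_zero_of_mul (b := ∏ j ∈ Finset.range n,
      ((lam w.delta).eval (n : ℂ) - (lam w.delta).eval (j : ℂ))) ?_
  rw [h.eval_poly]
  refine mul_ne_zero (Finset.prod_ne_zero_iff.2 fun j _ => ?_) (rising_ne_zero h.lt n)
  exact mul_ne_zero (Nat.cast_add_one_ne_zero j) h.ne_zero

/-- Apart from the rising factorial, the formula for the value at x₀ depends only on s and the
eigenvalues, which the two weights share. -/
theorem eval_poly_ratio (h : w.IsSingularPoint x₀ s e) (h' : w'.IsSingularPoint x₀ s e')
    (hl : lam w'.delta = lam w.delta) (n : ℕ) :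
    (w.poly n).eval x₀ * rising e' n = (w'.poly n).eval x₀ * rising e n := by
  have h1 := h.eval_poly n
  have h2 := h'.eval_poly n
  rw [hl] at h2
  have h3 : ∏ j ∈ Finset.range n,
      ((lam w.delta).eval (n : ℂ) - (lam w.delta).eval (j : ℂ)) ≠ 0 :=
    Finset.prod_ne_zero_iff.2 fun j hj => sub_ne_zero.2 fun e => by
      have := w.lam_delta_eval_injective e
      have := Finset.mem_range.1 hj
      omega
  apply mul_right_cancel₀ h3
  linear_combination rising e' n * h1 - rising e n * h2

/-- Comparison of the two sides of `p_n · D = λ(n) q_n` at a common singular point. -/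
theorem exists_mul_rising (h : w.IsSingularPoint x₀ s e) (h' : w'.IsSingularPoint x₀ s e')
    (hl : lam w'.delta = lam w.delta) {D : DiffOp (Fin 1) (Fin 1)} {l : ℂ[X]}
    (hD : Maps w w' D l) : ∃ A : ℂ[X], ∀ n : ℕ,
      l.eval (n : ℂ) * rising e' n = (A.comp (lam w'.delta)).eval (n : ℂ) * rising e n := by
  obtain ⟨A, hA⟩ := h.eval_app D
  refine ⟨A, fun n => ?_⟩
  have h1 := hA _ _ (w.app_delta_poly n)
  rw [hD, eval_mul, eval_C] at h1
  apply mul_right_cancel₀ (h'.eval_poly_ne_zero n)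
  rw [eval_comp, hl]
  linear_combination rising e' n * h1 +
    A.eval ((lam w.delta).eval (n : ℂ)) * h.eval_poly_ratio h' hl n

theorem comp_mem_eigAlg (A : ℂ[X]) (w : Classical) : A.comp (lam w.delta) ∈ w.eigAlg := by
  rw [Polynomial.comp_eq_aeval]
  exact aeval_mem_adjoin_singleton ℂ _

/-- For e = e' + k the quotient of rising factorials is a polynomial in n up to the nonzero constant
(e'+1) ⋯ (e'+k), which is absorbed into the eigenvalue algebra. -/
theorem exists_eq_risingShift_mul (h : w.IsSingularPoint x₀ s e)
    (h' : w'.IsSingularPoint x₀ s e') (hl : lam w'.delta = lam w.delta) (k : ℕ) (hk : e = e' + k)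
    {D : DiffOp (Fin 1) (Fin 1)} {l : ℂ[X]} (hD : Maps w w' D l) :
    ∃ a ∈ w'.eigAlg, l = risingShift e' k * a := by
  obtain ⟨A, hA⟩ := h.exists_mul_rising h' hl hD
  refine ⟨C (rising e' k)⁻¹ * A.comp (lam w'.delta),
    mul_mem (w'.eigAlg.algebraMap_mem _) (comp_mem_eigAlg A w'), eq_of_eval_natCast fun n => ?_⟩
  have h1 := rising_mul_risingShift e' k n
  rw [← hk] at h1
  have hne := rising_ne_zero h'.lt k
  rw [eval_mul, eval_mul, eval_C]
  apply mul_right_cancel₀ (mul_ne_zero hne (rising_ne_zero h'.lt n))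
  field_simp
  linear_combination rising e' k * hA n - (A.comp (lam w'.delta)).eval (n : ℂ) * h1

end IsSingularPoint

/-! ### Vanishing when the parameters are not linked -/

/-- Substituting x + 1 lowers each of the deg P roots, counted with multiplicity, by 1. -/
theorem sum_roots_comp_X_add_one (P : ℂ[X]) :
    (P.comp (X + 1)).roots.sum + P.natDegree = P.roots.sum := by
  have h := P.map_roots_comp_C_mul_X_add_C 1 1 isUnit_one
  have hc : (P.comp (X + 1)).natDegree = P.natDegree := by
    rw [natDegree_comp]
    have : (X + 1 : ℂ[X]).natDegree = 1 := by simpa using natDegree_X_add_C (1 : ℂ)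
    rw [this, mul_one]
  have hcard : (P.comp (X + 1)).roots.card = P.natDegree := by
    rw [← hc]
    exact (IsAlgClosed.splits _).natDegree_eq_card_roots.symm
  simp only [C_1, one_mul] at h
  conv_rhs => rw [← h]
  rw [Multiset.sum_map_add]
  simp [hcard]

/-- A ratio of polynomials that telescopes like a ratio of Gamma functions forces an integral
difference of the parameters. -/
theorem integral_of_shift_eq {P Q : ℂ[X]} (hP : P ≠ 0) (hQ : Q ≠ 0) (u v : ℂ)
    (h : P.comp (X + 1) * (X + C u) * Q = Q.comp (X + 1) * (X + C v) * P) :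
    ∃ k : ℤ, v - u = k := by
  have ne_comp {R : ℂ[X]} (hR : R ≠ 0) : R.comp (X + 1) ≠ 0 := fun h0 => hR <| by
    have h1 : taylor 1 R = 0 := by simpa [taylor_apply] using h0
    exact (taylor_eq_zero _ _).1 h1
  -- Comparing the sums of all roots, the roots of P and Q cancel up to their unit shifts, leaving v
  -- - u = deg P - deg Q.
  have h1 := congrArg (fun R : ℂ[X] => R.roots.sum) h
  have hu : X + C u ≠ 0 := X_add_C_ne_zero u
  have hv : X + C v ≠ 0 := X_add_C_ne_zero v
  rw [roots_mul (mul_ne_zero (mul_ne_zero (ne_comp hP) hu) hQ),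
    roots_mul (mul_ne_zero (ne_comp hP) hu),
    roots_mul (mul_ne_zero (mul_ne_zero (ne_comp hQ) hv) hP),
    roots_mul (mul_ne_zero (ne_comp hQ) hv)] at h1
  simp only [Multiset.sum_add, roots_X_add_C, Multiset.sum_singleton] at h1
  refine ⟨P.natDegree - Q.natDegree, ?_⟩
  push_cast
  linear_combination h1 - sum_roots_comp_X_add_one P + sum_roots_comp_X_add_one Q

theorem eq_zero_of_not_integral {P Q : ℂ[X]} {e e' : ℝ} (he : -1 < e) (he' : -1 < e')
    (h : ∀ n : ℕ, P.eval (n : ℂ) * rising e' n = Q.eval (n : ℂ) * rising e n)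
    (hne : ∀ k : ℤ, e - e' ≠ k) : P = 0 := by
  by_contra hP
  have hQ : Q ≠ 0 := by
    rintro rfl
    refine hP (eq_of_eval_natCast fun n => ?_)
    simpa [rising_ne_zero he' n] using h n
  -- The relations at n and n + 1 are divided, so that the rising factorials reduce to single linear
  -- factors.
  obtain ⟨k, hk⟩ := integral_of_shift_eq hP hQ (e' + 1) (e + 1) (by
    refine eq_of_eval_natCast fun n => ?_
    have h1 := h n
    have h2 := h (n + 1)
    rw [rising_succ, rising_succ] at h2
    push_cast at h2
    simp only [eval_mul, eval_comp, eval_add, eval_X, eval_one, eval_C]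
    apply mul_right_cancel₀ (rising_ne_zero he n)
    apply mul_right_cancel₀ (rising_ne_zero he' n)
    linear_combination (Q.eval (n : ℂ) * rising e n) * h2 -
      (Q.eval ((n : ℂ) + 1) * rising e n * ((n : ℂ) + e + 1)) * h1)
  refine hne k ?_
  have : (e : ℂ) - e' = k := by linear_combination hk
  exact_mod_cast this

/-- There are no operators between Jacobi polynomials with different values of `α + β`. -/
theorem eq_zero_of_jacobi_ne {α β α' β' : ℝ} {hα : -1 < α} {hβ : -1 < β} {hα' : -1 < α'}
    {hβ' : -1 < β'} (hne : α + β ≠ α' + β') {D : DiffOp (Fin 1) (Fin 1)} {l : ℂ[X]}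
    (hD : Maps (jacobi α β hα hβ) (jacobi α' β' hα' hβ') D l) : l = 0 := by
  set w := jacobi α β hα hβ with hw
  set w' := jacobi α' β' hα' hβ' with hw'
  have h : w.IsSingularPoint 1 (-2) α := isSingularPoint_jacobi_one α β hα hβ
  have h' : w'.IsSingularPoint 1 (-2) α' := isSingularPoint_jacobi_one α' β' hα' hβ'
  obtain ⟨A, hA⟩ := h.eval_app D
  -- Following D by ∂ gives the first derivative of λ(n) q_n at 1, which the recursion for w' ties
  -- to its value there.
  obtain ⟨B, hB⟩ := h.eval_app (MOP.comp D (sop 1 1))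
  have key : C (-2 * ((α' : ℂ) + 1)) * B.comp (lam w.delta) =
      lam w'.delta * A.comp (lam w.delta) := by
    refine eq_of_eval_natCast fun n => ?_
    have h1 := hA _ _ (w.app_delta_poly n)
    have h2 := hB _ _ (w.app_delta_poly n)
    have h3 := h'.recursion _ _ (w'.app_delta_poly n) 0
    rw [hD] at h1
    rw [app_comp, hD] at h2
    simp only [app_sop, Function.iterate_one, derivative_C_mul, mul_one, eval_mul, eval_C] at h1 h2
    rw [zero_add, taylor_coeff_one, taylor_coeff_zero] at h3
    have h4 : (lam w'.delta).eval ((0 : ℕ) : ℂ) = 0 := by simp [hw', lam_delta_jacobi]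
    rw [h4] at h3
    simp only [eval_mul, eval_C, eval_comp]
    apply mul_right_cancel₀ (h.eval_poly_ne_zero n)
    push_cast at h3
    linear_combination (-2 * ((α' : ℂ) + 1)) * (-h2) + l.eval (n : ℂ) * h3 +
      (lam w'.delta).eval (n : ℂ) * h1
  have hA0 : A.comp (lam w.delta) = 0 := by
    -- The reflection under which the eigenvalue of w is invariant. Reflecting `key` and subtracting
    -- leaves A(μ) times the change in the eigenvalue of w', a nonzero polynomial since the sums α +
    -- β differ.
    set r : ℂ[X] := -C ((α : ℂ) + β + 1) - X with hr
    have hsym : (lam w.delta).comp r = lam w.delta := by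
      simp [hw, lam_delta_jacobi, hr]
      ring
    have key' := congrArg (fun p : ℂ[X] => p.comp r) key
    simp only [mul_comp, C_comp, comp_assoc, hsym] at key'
    have hz : (lam w'.delta - (lam w'.delta).comp r) * A.comp (lam w.delta) = 0 := by
      linear_combination key' - key
    refine (mul_eq_zero.1 hz).resolve_left fun h0 => ?_
    have ev (z : ℂ) : (lam w'.delta - (lam w'.delta).comp r).eval z =
        ((α : ℂ) + β - (α' + β')) * (2 * z + (α + β + 1)) := by
      simp [hw', lam_delta_jacobi, hr]
      ring
    have h5 := ev 0
    have h6 := ev 1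
    rw [h0, eval_zero] at h5 h6
    have h7 : ((α : ℂ) + β - (α' + β')) = 0 := by
      linear_combination (h5 - h6) / 2
    exact hne (by exact_mod_cast sub_eq_zero.1 h7)
  refine eq_of_eval_natCast fun n => ?_
  have h1 := hA _ _ (w.app_delta_poly n)
  rw [← eval_comp, hA0, hD, eval_mul, eval_C, eval_zero, zero_mul] at h1
  simpa [h'.eval_poly_ne_zero n] using h1

/-! ### Hermite weights with different shifts -/

/-- The operator with differentiated coefficients. -/
def derivOp (D : DiffOp (Fin 1) (Fin 1)) : DiffOp (Fin 1) (Fin 1) :=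
  D.mapRange (fun M => !![derivative (M 0 0)]) (by ext a b; fin_cases a; fin_cases b; simp)

theorem derivative_app (D : DiffOp (Fin 1) (Fin 1)) (f : ℂ[X]) :
    derivative (app D f) = app D (derivative f) + app (derivOp D) f := by
  rw [app_apply, app_apply, app_apply, derivOp, Finsupp.sum_mapRange_index (by simp)]
  simp only [Finsupp.sum, derivative_sum, derivative_mul, ← Function.iterate_succ_apply']
  simp only [Function.iterate_succ_apply, Finset.sum_add_distrib]
  simp

/-- Only the derivative of order exactly k is nonzero at a, so testing on powers of x - a isolates
single coefficients of D. -/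
theorem eval_app_X_sub_C_pow (D : DiffOp (Fin 1) (Fin 1)) (a : ℂ) (k : ℕ) :
    (app D ((X - C a) ^ k)).eval a = k.factorial * (D k 0 0).eval a := by
  rw [app_apply, Finsupp.sum, eval_finsetSum, Finset.sum_eq_single k]
  · rw [eval_mul, iterate_derivative_X_sub_pow_self]
    simp
  · intro j _ hj
    rw [eval_mul, iterate_derivative_X_sub_pow]
    rcases lt_or_gt_of_ne hj with h | h
    · simp [Nat.sub_ne_zero_of_lt h]
    · simp [Nat.descFactorial_of_lt h]
  · intro hk
    simp [Finsupp.notMem_support_iff.1 hk]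

/-- There are no operators between Hermite polynomials with different shifts. -/
theorem eq_zero_of_hermite_ne {b b' : ℝ} (hne : b ≠ b') {D : DiffOp (Fin 1) (Fin 1)} {l : ℂ[X]}
    (hD : Maps (hermite b) (hermite b') D l) : l = 0 := by
  have hcomm : app (hermite b').delta ∘ₗ app D = app D ∘ₗ app (hermite b).delta := by
    refine (hermite b).hom_ext fun n => ?_
    rw [LinearMap.comp_apply, LinearMap.comp_apply, hD, app_delta_poly, app_C_mul, app_C_mul,
      app_delta_poly, hD, lam_delta_hermite, lam_delta_hermite]
    ring
  suffices hD0 : D = 0 by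
    rw [← hD.lam_eq, hD0, lam_zero]
  by_contra hD0
  have hsupp : D.support.Nonempty := Finsupp.support_nonempty_iff.2 hD0
  set m := D.support.max' hsupp with hm
  have hDm : D m 0 0 ≠ 0 := by
    have := Finsupp.mem_support_iff.1 (D.support.max'_mem hsupp)
    refine fun h0 => this ?_
    ext1 i j
    fin_cases i; fin_cases j
    exact h0
  have hDm' : D (m + 1) = 0 := by
    by_contra h0
    have := D.support.le_max' _ (Finsupp.mem_support_iff.2 h0)
    omega
  -- In the intertwining relation the two copies of g'' · D cancel.
  have key (g : ℂ[X]) : 2 * app (derivOp D) (derivative g) + app (derivOp (derivOp D)) g -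
      2 * (X - C (b' : ℂ)) * (app D (derivative g) + app (derivOp D) g) +
      C 2 * app D ((X - C (b : ℂ)) * derivative g) = 0 := by
    have h := congrArg (fun L : ℂ[X] →ₗ[ℂ] ℂ[X] => L g) hcomm
    have h2 : C (2 : ℂ) = 2 := map_ofNat C 2
    have h3 : derivative g * (-2 * (X - C (b : ℂ))) =
        C (-2) * ((X - C (b : ℂ)) * derivative g) := by
      rw [C_neg, h2]
      ring
    simp only [LinearMap.comp_apply, app_delta, sigma, tau, h3, mul_one, map_add, derivative_app,
      app_C_mul] at h
    rw [C_neg, h2] at h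
    rw [h2]
    linear_combination h
  -- With m the order of D, testing on (x - a)^(m+1) leaves only the coefficient of order m, since
  -- that of order m + 1 is zero.
  have hode : derivative (D m 0 0) = C ((b : ℂ) - b') * D m 0 0 := by
    refine Polynomial.funext fun a => ?_
    have h := congrArg (eval a) (key ((X - C a) ^ (m + 1)))
    have hd : derivative ((X - C a) ^ (m + 1)) = C ((m + 1 : ℕ) : ℂ) * (X - C a) ^ m := by
      simp [derivative_X_sub_C_pow]
    have hx : (X - C (b : ℂ)) * (C ((m + 1 : ℕ) : ℂ) * (X - C a) ^ m) =
        C ((m + 1 : ℕ) : ℂ) * ((X - C a) ^ (m + 1) + C (a - b) * (X - C a) ^ m) := by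
      rw [C_sub]
      ring
    rw [hd, hx] at h
    simp only [app_C_mul, map_add, eval_add, eval_sub, eval_mul, eval_C, eval_X,
      eval_app_X_sub_C_pow, eval_ofNat, eval_zero] at h
    have hz (k : ℕ) : (derivOp D k 0 0) = derivative (D k 0 0) := by simp [derivOp]
    have hz' (k : ℕ) : (derivOp (derivOp D) k 0 0) = derivative (derivative (D k 0 0)) := by
      simp [derivOp]
    rw [hz, hz, hz', hDm'] at h
    simp only [Matrix.zero_apply, derivative_zero, eval_zero, mul_zero, add_zero, zero_add] at h
    have hfac : (2 * ((m : ℂ) + 1) * m.factorial) ≠ 0 :=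
      mul_ne_zero (mul_ne_zero two_ne_zero (Nat.cast_add_one_ne_zero m))
        (by exact_mod_cast m.factorial_ne_zero)
    rw [eval_mul, eval_C]
    apply mul_left_cancel₀ hfac
    push_cast at h
    linear_combination h
  have hlt := degree_derivative_lt hDm
  rw [hode, degree_C_mul (sub_ne_zero.2 (by exact_mod_cast hne))] at hlt
  exact lt_irrefl _ hlt

end Classical

/-! ### The operators 𝒯 and the scalar classification -/

namespace Classical

theorem adjoin_C_mul {c : ℂ} (hc : c ≠ 0) (p : ℂ[X]) :
    Algebra.adjoin ℂ {C c * p} = Algebra.adjoin ℂ {p} := by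
  apply le_antisymm <;> refine Algebra.adjoin_le (Set.singleton_subset_iff.2 ?_)
  · exact mul_mem (Subalgebra.algebraMap_mem _ c) (Algebra.self_mem_adjoin_singleton ℂ p)
  · have := mul_mem (Subalgebra.algebraMap_mem (Algebra.adjoin ℂ {C c * p}) c⁻¹)
      (Algebra.self_mem_adjoin_singleton ℂ (C c * p))
    rwa [algebraMap_eq, ← mul_assoc, ← C_mul, inv_mul_cancel₀ hc, C_1, one_mul] at this

theorem eigAlg_hermite (b : ℝ) : (hermite b).eigAlg = ⊤ := by
  rw [eigAlg, lam_delta_hermite, adjoin_C_mul (by norm_num), adjoin_X]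

theorem eigAlg_laguerre (α : ℝ) (hα : -1 < α) : (laguerre α hα).eigAlg = ⊤ := by
  rw [eigAlg, lam_delta_laguerre, neg_eq_neg_one_mul, ← C_1, ← C_neg,
    adjoin_C_mul (by norm_num), adjoin_X]

theorem eigAlg_jacobi (α β : ℝ) (hα : -1 < α) (hβ : -1 < β) :
    (jacobi α β hα hβ).eigAlg = Algebra.adjoin ℂ {(X * (X + C ((α : ℂ) + β + 1)) : ℂ[X])} := by
  rw [eigAlg, lam_delta_jacobi, neg_eq_neg_one_mul (X * _ : ℂ[X]), ← C_1, ← C_neg,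
    adjoin_C_mul (by norm_num)]

theorem T_hermite_self (b : ℝ) : (hermite b).T (hermite b) = sop 0 1 := by
  simp [T]

theorem T_hermite_of_ne {b b' : ℝ} (h : b ≠ b') : (hermite b).T (hermite b') = 0 := by
  simp [T, h]

theorem T_laguerre_raise {α α' : ℝ} (hα : -1 < α) (hα' : -1 < α') (k : ℕ) (h : α' = α + k) :
    (laguerre α hα).T (laguerre α' hα') = oneSubPow k := by
  have hex : ∃ k : ℕ, α' = α + k := ⟨k, h⟩
  have : hex.choose = k := by
    have := hex.choose_spec
    exact_mod_cast (add_left_cancel (h.symm.trans this)).symm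
  rw [T, dif_pos hex, this]

/-- The branches of the definition overlap only for k = 0, where both operators are 1. -/
theorem T_laguerre_lower {α α' : ℝ} (hα : -1 < α) (hα' : -1 < α') (k : ℕ) (h : α = α' + k) :
    (laguerre α hα).T (laguerre α' hα') = shiftProd X α' k := by
  by_cases hex : ∃ k : ℕ, α' = α + k
  · obtain ⟨j, hj⟩ := hex
    have hjk : (j : ℝ) + k = 0 := by linarith
    have hk : k = 0 := by
      have : j + k = 0 := by exact_mod_cast hjk
      omega
    subst hk
    rw [T_laguerre_raise hα hα' 0 (by simpa using h.symm)]
    rfl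
  · have hex' : ∃ k : ℕ, α = α' + k := ⟨k, h⟩
    have : hex'.choose = k := by
      have := hex'.choose_spec
      exact_mod_cast (add_left_cancel (h.symm.trans this)).symm
    rw [T, dif_neg hex, dif_pos hex', this]

theorem T_laguerre_of_not {α α' : ℝ} (hα : -1 < α) (hα' : -1 < α')
    (h : ¬ ∃ k : ℕ, α' = α + k) (h' : ¬ ∃ k : ℕ, α = α' + k) :
    (laguerre α hα).T (laguerre α' hα') = 0 := by
  rw [T, dif_neg h, dif_neg h']

theorem T_jacobi_raise {α β α' β' : ℝ} (hα : -1 < α) (hβ : -1 < β) (hα' : -1 < α')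
    (hβ' : -1 < β') (k : ℕ) (h : α' = α + k) (h' : β = β' + k) :
    (jacobi α β hα hβ).T (jacobi α' β' hα' hβ') = shiftProd (1 + X) β' k := by
  have hex : ∃ k : ℕ, α' = α + k ∧ β = β' + k := ⟨k, h, h'⟩
  have : hex.choose = k := by
    have := hex.choose_spec.1
    exact_mod_cast (add_left_cancel (h.symm.trans this)).symm
  rw [T, dif_pos hex, this]

theorem T_jacobi_lower {α β α' β' : ℝ} (hα : -1 < α) (hβ : -1 < β) (hα' : -1 < α')
    (hβ' : -1 < β') (k : ℕ) (h : α = α' + k) (h' : β' = β + k) :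
    (jacobi α β hα hβ).T (jacobi α' β' hα' hβ') = shiftProd (X - 1) α' k := by
  by_cases hex : ∃ k : ℕ, α' = α + k ∧ β = β' + k
  · obtain ⟨j, hj, -⟩ := hex
    have hjk : (j : ℝ) + k = 0 := by linarith
    have hk : k = 0 := by
      have : j + k = 0 := by exact_mod_cast hjk
      omega
    subst hk
    rw [T_jacobi_raise hα hβ hα' hβ' 0 (by simpa using h.symm) (by simpa using h'.symm)]
    rfl
  · have hex' : ∃ k : ℕ, α = α' + k ∧ β' = β + k := ⟨k, h, h'⟩
    have : hex'.choose = k := by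
      have := hex'.choose_spec.1
      exact_mod_cast (add_left_cancel (h.symm.trans this)).symm
    rw [T, dif_neg hex, dif_pos hex', this]

theorem T_jacobi_of_not {α β α' β' : ℝ} (hα : -1 < α) (hβ : -1 < β) (hα' : -1 < α')
    (hβ' : -1 < β') (h : ¬ ∃ k : ℕ, α' = α + k ∧ β = β' + k)
    (h' : ¬ ∃ k : ℕ, α = α' + k ∧ β' = β + k) :
    (jacobi α β hα hβ).T (jacobi α' β' hα' hβ') = 0 := by
  rw [T, dif_neg h, dif_neg h']

/-- The possibilities for `𝒯_{w,w'}`. -/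
theorem T_eq_zero_or_maps (w w' : Classical) :
    w.T w' = 0 ∨ w.SameType w' ∧
      ∃ l l' : ℂ[X], Maps w w' (w.T w') l ∧ Maps w' w (w'.T w) l' ∧
        (∀ n : ℕ, l.eval (n : ℂ) ≠ 0) ∧ ∀ n : ℕ, l'.eval (n : ℂ) ≠ 0 := by
  cases w with
  | hermite b =>
    cases w' with
    | hermite b' =>
      by_cases h : b = b'
      · subst h
        refine Or.inr ⟨trivial, 1, 1, ?_, ?_, by simp, by simp⟩ <;>
        · rw [T_hermite_self]
          exact maps_C _ 1
      · exact Or.inl (T_hermite_of_ne h)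
    | laguerre => exact Or.inl rfl
    | jacobi => exact Or.inl rfl
  | laguerre α hα =>
    cases w' with
    | hermite => exact Or.inl rfl
    | laguerre α' hα' =>
      by_cases h : ∃ k : ℕ, α' = α + k
      · obtain ⟨k, hk⟩ := h
        refine Or.inr ⟨trivial, 1, risingShift α k, ?_, ?_, by simp,
          eval_risingShift_ne_zero α hα k⟩
        · rw [T_laguerre_raise hα hα' k hk]
          exact maps_oneSubPow k α α' hα hα' hk
        · rw [T_laguerre_lower hα' hα k hk]
          exact maps_shiftProd_laguerre k α' α hα' hα hk
      · by_cases h' : ∃ k : ℕ, α = α' + k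
        · obtain ⟨k, hk⟩ := h'
          refine Or.inr ⟨trivial, risingShift α' k, 1, ?_, ?_,
            eval_risingShift_ne_zero α' hα' k, by simp⟩
          · rw [T_laguerre_lower hα hα' k hk]
            exact maps_shiftProd_laguerre k α α' hα hα' hk
          · rw [T_laguerre_raise hα' hα k hk]
            exact maps_oneSubPow k α' α hα' hα hk
        · exact Or.inl (T_laguerre_of_not hα hα' h h')
    | jacobi => exact Or.inl rfl
  | jacobi α β hα hβ =>
    cases w' with
    | hermite => exact Or.inl rfl
    | laguerre => exact Or.inl rfl
    | jacobi α' β' hα' hβ' =>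
      by_cases h : ∃ k : ℕ, α' = α + k ∧ β = β' + k
      · obtain ⟨k, hk, hk'⟩ := h
        refine Or.inr ⟨trivial, risingShift β' k, risingShift α k, ?_, ?_,
          eval_risingShift_ne_zero β' hβ' k, eval_risingShift_ne_zero α hα k⟩
        · rw [T_jacobi_raise hα hβ hα' hβ' k hk hk']
          exact maps_shiftProd_jacobi_raise k α β α' β' hα hβ hα' hβ' hk hk'
        · rw [T_jacobi_lower hα' hβ' hα hβ k hk hk']
          exact maps_shiftProd_jacobi_lower k α' β' α β hα' hβ' hα hβ hk hk'
      · by_cases h' : ∃ k : ℕ, α = α' + k ∧ β' = β + k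
        · obtain ⟨k, hk, hk'⟩ := h'
          refine Or.inr ⟨trivial, risingShift α' k, risingShift β k, ?_, ?_,
            eval_risingShift_ne_zero α' hα' k, eval_risingShift_ne_zero β hβ k⟩
          · rw [T_jacobi_lower hα hβ hα' hβ' k hk hk']
            exact maps_shiftProd_jacobi_lower k α β α' β' hα hβ hα' hβ' hk hk'
          · rw [T_jacobi_raise hα' hβ' hα hβ k hk hk']
            exact maps_shiftProd_jacobi_raise k α' β' α β hα' hβ' hα hβ hk hk'
        · exact Or.inl (T_jacobi_of_not hα hβ hα' hβ' h h')

theorem maps_T (w w' : Classical) : Maps w w' (w.T w') (lam (w.T w')) := by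
  rcases T_eq_zero_or_maps w w' with h | ⟨-, l, l', h, -⟩
  · rw [h, lam_zero]
    exact maps_zero w w'
  · rwa [h.lam_eq]

theorem lam_T_self (w : Classical) : lam (w.T w) = 1 := by
  cases w with
  | hermite b =>
    rw [T_hermite_self]
    exact (maps_C (hermite b) 1).lam_eq
  | laguerre α hα =>
    rw [T_laguerre_raise hα hα 0 (by simp)]
    exact (maps_oneSubPow 0 α α hα hα (by simp)).lam_eq
  | jacobi α β hα hβ =>
    rw [T_jacobi_raise hα hβ hα hβ 0 (by simp) (by simp)]
    exact (maps_C (jacobi α β hα hβ) 1).lam_eq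

/-- Operators mapping orthogonal polynomials to orthogonal polynomials factor through `𝒯`, at the
level of eigenvalues. -/
theorem Maps.exists_eq_lam_T_mul {w w' : Classical} (hs : w.SameType w')
    {D : DiffOp (Fin 1) (Fin 1)} {l : ℂ[X]} (hD : Maps w w' D l) :
    ∃ a ∈ w'.eigAlg, l = lam (w.T w') * a := by
  cases w with
  | hermite b =>
    cases w' with
    | hermite b' =>
      by_cases h : b = b'
      · subst h
        refine ⟨l, ?_, by rw [lam_T_self, one_mul]⟩
        rw [eigAlg_hermite]
        trivial
      · exact ⟨0, zero_mem _, by rw [eq_zero_of_hermite_ne h hD, mul_zero]⟩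
    | laguerre => exact hs.elim
    | jacobi => exact hs.elim
  | laguerre α hα =>
    cases w' with
    | hermite => exact hs.elim
    | laguerre α' hα' =>
      have hl : lam (laguerre α' hα').delta = lam (laguerre α hα).delta := by
        rw [lam_delta_laguerre, lam_delta_laguerre]
      by_cases h : ∃ k : ℕ, α' = α + k
      · obtain ⟨k, hk⟩ := h
        refine ⟨l, ?_, ?_⟩
        · rw [eigAlg_laguerre]
          trivial
        · rw [T_laguerre_raise hα hα' k hk, (maps_oneSubPow k α α' hα hα' hk).lam_eq, one_mul]
      · by_cases h' : ∃ k : ℕ, α = α' + k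
        · obtain ⟨k, hk⟩ := h'
          rw [T_laguerre_lower hα hα' k hk, (maps_shiftProd_laguerre k α α' hα hα' hk).lam_eq]
          exact (isSingularPoint_laguerre α hα).exists_eq_risingShift_mul
            (isSingularPoint_laguerre α' hα') hl k hk hD
        · obtain ⟨A, hA⟩ := (isSingularPoint_laguerre α hα).exists_mul_rising
            (isSingularPoint_laguerre α' hα') hl hD
          refine ⟨0, zero_mem _, ?_⟩
          rw [mul_zero]
          refine eq_zero_of_not_integral hα hα' hA fun k hk => ?_
          obtain ⟨j, rfl | rfl⟩ := k.eq_nat_or_neg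
          · exact h' ⟨j, by push_cast at hk; linarith⟩
          · exact h ⟨j, by push_cast at hk; linarith⟩
    | jacobi => exact hs.elim
  | jacobi α β hα hβ =>
    cases w' with
    | hermite => exact hs.elim
    | laguerre => exact hs.elim
    | jacobi α' β' hα' hβ' =>
      -- Equality of the sums makes the eigenvalues agree, so the singular points apply: -1 compares
      -- the exponents β and 1 compares the exponents α.
      by_cases hc : α + β = α' + β'
      · have hl : lam (jacobi α' β' hα' hβ').delta = lam (jacobi α β hα hβ).delta := by
          have hc' : (α : ℂ) + β = α' + β' := by exact_mod_cast hc
          rw [lam_delta_jacobi, lam_delta_jacobi, hc']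
        by_cases h : ∃ k : ℕ, α' = α + k
        · obtain ⟨k, hk⟩ := h
          have hk' : β = β' + k := by linarith
          rw [T_jacobi_raise hα hβ hα' hβ' k hk hk',
            (maps_shiftProd_jacobi_raise k α β α' β' hα hβ hα' hβ' hk hk').lam_eq]
          exact (isSingularPoint_jacobi_neg_one α β hα hβ).exists_eq_risingShift_mul
            (isSingularPoint_jacobi_neg_one α' β' hα' hβ') hl k hk' hD
        · by_cases h' : ∃ k : ℕ, α = α' + k
          · obtain ⟨k, hk⟩ := h'
            have hk' : β' = β + k := by linarith
            rw [T_jacobi_lower hα hβ hα' hβ' k hk hk',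
              (maps_shiftProd_jacobi_lower k α β α' β' hα hβ hα' hβ' hk hk').lam_eq]
            exact (isSingularPoint_jacobi_one α β hα hβ).exists_eq_risingShift_mul
              (isSingularPoint_jacobi_one α' β' hα' hβ') hl k hk hD
          · obtain ⟨A, hA⟩ := (isSingularPoint_jacobi_one α β hα hβ).exists_mul_rising
              (isSingularPoint_jacobi_one α' β' hα' hβ') hl hD
            refine ⟨0, zero_mem _, ?_⟩
            rw [mul_zero]
            refine eq_zero_of_not_integral hα hα' hA fun k hk => ?_
            obtain ⟨j, rfl | rfl⟩ := k.eq_nat_or_neg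
            · exact h' ⟨j, by push_cast at hk; linarith⟩
            · exact h ⟨j, by push_cast at hk; linarith⟩
      · exact ⟨0, zero_mem _, by rw [eq_zero_of_jacobi_ne hc hD, mul_zero]⟩

theorem exists_maps_iff {w w' : Classical} (hs : w.SameType w') (l : ℂ[X]) :
    (∃ D, Maps w w' D l) ↔ ∃ a ∈ w'.eigAlg, l = lam (w.T w') * a := by
  constructor
  · rintro ⟨D, hD⟩
    exact hD.exists_eq_lam_T_mul hs
  · rintro ⟨a, ha, rfl⟩
    obtain ⟨E, hE⟩ := w'.exists_maps_of_mem_eigAlg ha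
    exact ⟨_, (maps_T w w').comp hE⟩

theorem SameType.interval_eq {w w' : Classical} (h : w.SameType w') :
    w.interval = w'.interval := by
  cases w <;> cases w' <;> first | rfl | exact h.elim

end Classical

/-! ### Reduction of direct sums to their entries -/

open MOP.Classical

variable {N : ℕ} {w : Fin N → Classical}

/-- The diagonal sequence of monic orthogonal polynomials of a direct sum. -/
def diagPoly (w : Fin N → Classical) (n : ℕ) : Matrix (Fin N) (Fin N) ℂ[X] :=
  Matrix.diagonal fun i => (w i).poly n

theorem inner_directSum (hw : ∀ i j, (w i).SameType (w j))
    (P Q : Matrix (Fin N) (Fin N) ℂ[X]) (i j : Fin N) :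
    inner (directSum w) P Q i j = ∑ l, (w l).functional (P i l * conj (Q j l)) := by
  have hsupp (l : Fin N) : (⋂ j, (w j).interval) = (w l).interval := by
    rw [Set.iInter_congr fun j => (hw j l).interval_eq]
    have : Nonempty (Fin N) := ⟨l⟩
    exact Set.iInter_const _
  have hterm (x : ℝ) : (matEval P x * (directSum w).dens x * (matEval Q x).conjTranspose) i j =
      ∑ l, (P i l * conj (Q j l)).eval (x : ℂ) * ((w l).density x : ℂ) := by
    rw [Matrix.mul_apply]
    simp only [directSum, Matrix.mul_diagonal, matEval, Matrix.map_apply,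
      Matrix.conjTranspose_apply, eval_mul, eval_conj]
    exact Finset.sum_congr rfl fun l _ => by ring
  simp only [inner, Matrix.of_apply, hterm]
  simp only [directSum]
  rw [MeasureTheory.integral_finsetSum]
  · refine Finset.sum_congr rfl fun l _ => ?_
    rw [hsupp l, functional_apply]
  · intro l _
    rw [hsupp l]
    exact (w l).integrableOn_eval_mul _

theorem matCoeff_diagPoly (w : Fin N → Classical) (n : ℕ) : matCoeff (diagPoly w n) n = 1 := by
  ext i j
  by_cases h : i = j
  · subst h
    simp [matCoeff, diagPoly, poly_coeff_self]
  · simp [matCoeff, diagPoly, h]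

theorem isOrthogonalSeq_diagPoly (hw : ∀ i j, (w i).SameType (w j)) :
    IsOrthogonalSeq (directSum w) (diagPoly w) where
  degree_le n i j := by
    by_cases h : i = j
    · subst h
      simpa [diagPoly] using (w i).poly_degree_le n
    · simp [diagPoly, h]
  leading n := by
    rw [matCoeff_diagPoly]
    exact isUnit_one
  orth n m hnm := by
    ext i j
    rw [inner_directSum hw, Matrix.zero_apply]
    refine Finset.sum_eq_zero fun l _ => ?_
    by_cases hi : i = l
    · by_cases hj : j = l
      · subst hi
        subst hj
        simp only [diagPoly, Matrix.diagonal_apply_eq, conj_poly]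
        exact functional_poly_mul_poly _ hnm
      · simp [diagPoly, hj]
    · simp [diagPoly, hi]

/-- Orthogonal polynomials are orthogonal to all polynomials of lower degree. -/
theorem IsOrthogonalSeq.inner_eq_zero (hw : ∀ i j, (w i).SameType (w j))
    {P : ℕ → Matrix (Fin N) (Fin N) ℂ[X]} (hP : IsOrthogonalSeq (directSum w) P) (n k : ℕ)
    (hk : k ≤ n) (Q : Matrix (Fin N) (Fin N) ℂ[X]) (hQ : ∀ i j, (Q i j).degree < k) :
    inner (directSum w) (P n) Q = 0 := by
  induction k generalizing Q with
  | zero =>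
    have : Q = 0 := by
      ext1 i j
      simpa using hQ i j
    ext i j
    simp [inner_directSum hw, this]
  | succ k ih =>
    -- B P_k has the same coefficient of x^k as Q, so subtracting it lowers the degree.
    set B := matCoeff Q k * (matCoeff (P k) k)⁻¹ with hB
    have hBP : B * matCoeff (P k) k = matCoeff Q k := by
      rw [hB, Matrix.mul_assoc, Matrix.nonsing_inv_mul _
        ((Matrix.isUnit_iff_isUnit_det _).1 (hP.leading k)), Matrix.mul_one]
    have h0 := ih (by omega) (Q - B.map C * P k) (fun i j => by
      apply degree_lt_of_coeff_eq_zero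
      · rw [Matrix.sub_apply]
        refine (degree_sub_le _ _).trans (max_le ?_ ?_)
        · rw [degree_le_iff_coeff_zero]
          intro m hm
          exact (degree_lt_iff_coeff_zero _ _).1 (hQ i j) m (by exact_mod_cast hm)
        · rw [Matrix.mul_apply]
          refine (degree_sum_le _ _).trans (Finset.sup_le fun l _ => ?_)
          rw [Matrix.map_apply, ← smul_eq_C_mul]
          exact (degree_smul_le _ _).trans (hP.degree_le k l j)
      · have := congrFun (congrFun hBP i) j
        simp only [Matrix.mul_apply, matCoeff, Matrix.map_apply] at this
        simp only [Matrix.sub_apply, Matrix.mul_apply, coeff_sub, finsetSum_coeff,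
          Matrix.map_apply, coeff_C_mul]
        rw [this, sub_self])
    have h1 := hP.orth n k (by omega)
    ext i j
    have h0' := congrFun (congrFun h0 i) j
    rw [inner_directSum hw] at h0' ⊢
    have h2 : ∑ l, (w l).functional (P n i l * conj ((B.map C * P k) j l)) = 0 := by
      have h3 (l : Fin N) : (w l).functional (P n i l * conj ((B.map C * P k) j l)) =
          ∑ m, starRingEnd ℂ (B j m) * (w l).functional (P n i l * conj (P k m l)) := by
        simp only [Matrix.mul_apply, conj, Polynomial.map_sum, Polynomial.map_mul,
          Matrix.map_apply, map_C, Finset.mul_sum, map_sum]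
        refine Finset.sum_congr rfl fun m _ => ?_
        rw [mul_left_comm, ← smul_eq_C_mul, map_smul, smul_eq_mul]
      simp only [h3]
      rw [Finset.sum_comm]
      refine Finset.sum_eq_zero fun m _ => ?_
      rw [← Finset.mul_sum]
      have h4 := congrFun (congrFun h1 i) m
      rw [inner_directSum hw] at h4
      rw [h4]
      simp
    simp only [Matrix.sub_apply, conj, Polynomial.map_sub, mul_sub, map_sub,
      Finset.sum_sub_distrib, Matrix.zero_apply] at h0' ⊢
    rwa [show _ = (0 : ℂ) from h2, sub_zero] at h0'

/-- Every sequence of orthogonal polynomials of a direct sum is a constant multiple of the diagonal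
one. -/
theorem IsOrthogonalSeq.eq_mul_diagPoly (hw : ∀ i j, (w i).SameType (w j))
    {P : ℕ → Matrix (Fin N) (Fin N) ℂ[X]} (hP : IsOrthogonalSeq (directSum w) P) (n : ℕ) :
    P n = (matCoeff (P n) n).map C * diagPoly w n := by
  ext1 i l
  rw [diagPoly, Matrix.mul_diagonal, Matrix.map_apply, matCoeff, Matrix.map_apply]
  refine (w l).eq_C_mul_poly_of_orthogonal (hP.degree_le n i l) fun k hk => ?_
  -- Testing against a matrix supported in row i and column l isolates one entry of P_n and one
  -- scalar weight.
  have h := hP.inner_eq_zero hw n n le_rfl (Matrix.single i l ((w l).poly k)) (fun a b => by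
    rw [Matrix.single_apply]
    split_ifs
    · exact ((w l).poly_degree_le k).trans_lt (by exact_mod_cast hk)
    · simp)
  have h' := congrFun (congrFun h i) i
  rw [inner_directSum hw, Finset.sum_eq_single l] at h'
  · simpa [conj_poly] using h'
  · intro b _ hb
    simp [hb.symm]
  · simp

theorem act_C_mul {r m n : Type} [Fintype r] [Fintype m] (A : Matrix r r ℂ)
    (P : Matrix r m ℂ[X]) (D : DiffOp m n) : act (A.map C * P) D = A.map C * act P D := by
  ext1 i j
  simp only [act_apply, Matrix.mul_apply, Matrix.map_apply, map_sum, app_C_mul, Finset.mul_sum]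
  exact Finset.sum_comm

theorem act_diagPoly (D : DiffOp (Fin N) (Fin N)) (n : ℕ) (i j : Fin N) :
    act (diagPoly w n) D i j = app (entry D i j) ((w i).poly n) := by
  rw [act_apply, Finset.sum_eq_single i]
  · simp [diagPoly]
  · intro b _ hb
    simp [diagPoly, hb.symm]
  · simp

/-- On the diagonal sequence the eigenvalue equation is one scalar equation per entry. Any other
orthogonal sequence is a constant left multiple of it, and left constants commute with the right
action. -/
theorem mem_diffAlgebra_iff (hw : ∀ i j, (w i).SameType (w j)) (D : DiffOp (Fin N) (Fin N)) :
    D ∈ diffAlgebra (directSum w) ↔ ∀ i j, Maps (w i) (w j) (entry D i j) (Lam D i j) := by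
  constructor
  · intro hD i j
    choose A hA using hD _ (isOrthogonalSeq_diagPoly hw)
    have h (n : ℕ) : app (entry D i j) ((w i).poly n) = C (A n i j) * (w j).poly n := by
      rw [← act_diagPoly, hA n]
      simp [diagPoly]
    intro n
    rw [h, eq_lam_of_mapsTo h n, lam_entry]
  · intro hD P hP n
    have hdet : IsUnit (matCoeff (P n) n).det :=
      (Matrix.isUnit_iff_isUnit_det _).1 (hP.leading n)
    -- Passing from the diagonal sequence to P conjugates the eigenvalue by the leading coefficient.
    refine ⟨matCoeff (P n) n * (Lam D).map (fun p => p.eval (n : ℂ)) * (matCoeff (P n) n)⁻¹, ?_⟩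
    have h1 : act (diagPoly w n) D =
        ((Lam D).map (fun p => p.eval (n : ℂ))).map C * diagPoly w n := by
      ext1 i j
      rw [act_diagPoly, hD i j n]
      simp [diagPoly]
    conv_lhs => rw [hP.eq_mul_diagPoly hw n, act_C_mul, h1]
    conv_rhs => rw [hP.eq_mul_diagPoly hw n]
    rw [← Matrix.mul_assoc, ← Matrix.mul_assoc, ← Matrix.map_mul, ← Matrix.map_mul]
    have : matCoeff ((matCoeff (P n) n).map C * diagPoly w n) n = matCoeff (P n) n := by
      rw [← hP.eq_mul_diagPoly hw n]
    rw [this, Matrix.mul_assoc _ (matCoeff (P n) n)⁻¹, Matrix.nonsing_inv_mul _ hdet,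
      Matrix.mul_one]

/-- The matrix operator with the given entries. -/
def ofEntries (E : Fin N → Fin N → DiffOp (Fin 1) (Fin 1)) : DiffOp (Fin N) (Fin N) :=
  ∑ i, ∑ j, (E i j).mapRange (fun M => Matrix.single i j (M 0 0)) (by simp)

theorem entry_ofEntries (E : Fin N → Fin N → DiffOp (Fin 1) (Fin 1)) (i j : Fin N) :
    entry (ofEntries E) i j = E i j := by
  ext1 k
  ext1 a b
  fin_cases a
  fin_cases b
  simp only [entry, ofEntries, Finsupp.mapRange_apply, Finsupp.finsetSum_apply,
    Matrix.sum_apply, Matrix.single_apply]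
  rw [Finset.sum_eq_single i (fun a _ ha => Finset.sum_eq_zero fun b _ => by simp [ha])
    (by simp), Finset.sum_eq_single j (fun b _ hb => by simp [hb]) (by simp)]
  simp

/-- The conditions on different entries are unrelated, so scalar operators chosen separately
assemble into one element of 𝒟(W). -/
theorem mem_eigenvalueAlgebra_iff (hw : ∀ i j, (w i).SameType (w j))
    (M : Matrix (Fin N) (Fin N) ℂ[X]) :
    M ∈ eigenvalueAlgebra (directSum w) ↔ ∀ i j, ∃ D, Maps (w i) (w j) D (M i j) := by
  constructor
  · rintro ⟨D, hD, rfl⟩ i j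
    exact ⟨_, (mem_diffAlgebra_iff hw D).1 hD i j⟩
  · intro h
    choose E hE using h
    have hL (i j : Fin N) : Lam (ofEntries E) i j = M i j := by
      rw [← lam_entry, entry_ofEntries, (hE i j).lam_eq]
    refine ⟨ofEntries E, (mem_diffAlgebra_iff hw _).2 fun i j => ?_, ?_⟩
    · rw [entry_ofEntries, hL]
      exact hE i j
    · ext1 i j
      exact hL i j

theorem mem_iSup_entrySpace_iff (M : Matrix (Fin N) (Fin N) ℂ[X]) :
    M ∈ (⨆ i, ⨆ j, entrySpace (w i) (w j) i j : Submodule ℂ (Matrix (Fin N) (Fin N) ℂ[X])) ↔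
      ∀ i j, ∃ a ∈ (w j).eigAlg, M i j = lam ((w i).T (w j)) * a := by
  constructor
  · intro h i j
    let S : Submodule ℂ (Matrix (Fin N) (Fin N) ℂ[X]) :=
      ((Subalgebra.toSubmodule (w j).eigAlg).map
        (LinearMap.mulLeft ℂ (lam ((w i).T (w j))))).comap (Matrix.entryLinearMap ℂ ℂ[X] i j)
    have hle : (⨆ i, ⨆ j, entrySpace (w i) (w j) i j) ≤ S := by
      refine iSup₂_le fun i' j' => ?_
      rintro _ ⟨a, ha, rfl⟩
      by_cases hij : i' = i ∧ j' = j
      · obtain ⟨rfl, rfl⟩ := hij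
        exact ⟨a, ha, by simp⟩
      · refine ⟨0, zero_mem _, ?_⟩
        simp [hij]
    obtain ⟨a, ha, e⟩ := hle h
    exact ⟨a, ha, e.symm⟩
  · intro h
    rw [Matrix.matrix_eq_sum_single M]
    refine sum_mem fun i _ => sum_mem fun j _ => ?_
    obtain ⟨a, ha, e⟩ := h i j
    refine Submodule.mem_iSup_of_mem i (Submodule.mem_iSup_of_mem j ⟨a, ha, ?_⟩)
    simp [e]

theorem eigenvalueAlgebra_directSum (hw : ∀ i j, (w i).SameType (w j)) :
    eigenvalueAlgebra (directSum w) =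
      ((⨆ i, ⨆ j, entrySpace (w i) (w j) i j :
        Submodule ℂ (Matrix (Fin N) (Fin N) ℂ[X])) : Set (Matrix (Fin N) (Fin N) ℂ[X])) := by
  ext M
  rw [mem_eigenvalueAlgebra_iff hw, SetLike.mem_coe, mem_iSup_entrySpace_iff]
  exact forall₂_congr fun i j => exists_maps_iff (hw i j) _

/-! ### Darboux transformations -/

namespace Classical

theorem SameType.refl (w : Classical) : w.SameType w := by
  cases w <;> trivial

theorem weight_eq_directSum (w : Classical) : w.weight = directSum fun _ : Fin 1 => w := by
  rw [weight, directSum, Set.iInter_const]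
  congr 1
  funext x
  ext i j
  fin_cases i
  fin_cases j
  simp

theorem matDegree_one_one (P : Matrix (Fin 1) (Fin 1) ℂ[X]) : matDegree P = (P 0 0).degree := by
  simp [matDegree]

/-- The operator multiplies the leading coefficient of a polynomial of degree d by l(d), which is
nonzero. -/
theorem Maps.degreePreserving {w w' : Classical} {D : DiffOp (Fin 1) (Fin 1)} {l : ℂ[X]}
    (hD : Maps w w' D l) (hl : ∀ n : ℕ, l.eval (n : ℂ) ≠ 0) : DegreePreserving D := by
  intro P
  rw [act_one_one, matDegree_one_one, matDegree_one_one]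
  simp only [Matrix.of_apply, Matrix.cons_val_fin_one]
  set f := P 0 0
  by_cases hf : f = 0
  · rw [hf, map_zero]
  · obtain ⟨h1, h2⟩ := coeff_app (degree_of_mapsTo hD) (f := f) degree_le_natDegree
    rw [degree_eq_natDegree hf]
    refine le_antisymm h1 (le_degree_of_ne_zero ?_)
    rw [h2, hD.lam_eq]
    exact mul_ne_zero (hl _) (by simpa using hf)

/-- A nonzero 𝒯 from w₁ to w₂ has a companion 𝒯 from w₂ to w₁. Both preserve degrees, and the round
trip from w₂ acts on the orthogonal polynomials of w₂ by scalars, so it lies in 𝒟(w₂). -/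
theorem isDarboux_of_lam_T_ne_zero (w₁ w₂ : Classical) (h : lam (w₁.T w₂) ≠ 0) :
    IsDarboux w₂.weight w₁.weight := by
  rcases T_eq_zero_or_maps w₁ w₂ with h0 | ⟨hs, l, l', hl, hl', hne, hne'⟩
  · exact absurd (by rw [h0, lam_zero]) h
  have hs' (w : Classical) : ∀ i j : Fin 1, SameType ((fun _ => w) i) ((fun _ => w) j) :=
    fun _ _ => SameType.refl w
  have hentry (D : DiffOp (Fin 1) (Fin 1)) (i j : Fin 1) : entry D i j = D := by
    ext1 k
    ext1 a b
    fin_cases a; fin_cases b; fin_cases i; fin_cases j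
    simp [entry]
  refine ⟨hs.interval_eq.symm, comp (w₂.T w₁) (w₁.T w₂), ?_, w₂.T w₁, w₁.T w₂, rfl,
    hl'.degreePreserving hne', hl.degreePreserving hne, fun P P' hP hP' n => ⟨?_, ?_⟩⟩
  · rw [weight_eq_directSum, mem_diffAlgebra_iff (hs' w₂)]
    intro i j
    have := hl'.comp hl
    rw [← lam_entry, hentry, this.lam_eq]
    exact this
  · exact (Matrix.diagonal fun _ => l'.eval (n : ℂ))
  · rw [weight_eq_directSum] at hP hP'
    rw [hP.toIsOrthogonalSeq.eq_mul_diagPoly (hs' w₂) n,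
      hP'.toIsOrthogonalSeq.eq_mul_diagPoly (hs' w₁) n, hP.monic, hP'.monic,
      Matrix.map_one C C_0 C_1, Matrix.one_mul, Matrix.one_mul]
    ext1 i j
    rw [act_diagPoly, hentry, hl']
    fin_cases i
    fin_cases j
    simp [diagPoly]

end Classical

end

end MOP

theorem theorem5p3 :
    -- the eigenvalue algebra of a direct sum of classical weights of the same type
    (∀ (N : ℕ) (w : Fin N → MOP.Classical), (∀ i j, (w i).SameType (w j)) →
      MOP.eigenvalueAlgebra (MOP.directSum w) =
        ((⨆ i, ⨆ j, MOP.entrySpace (w i) (w j) i j :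
          Submodule ℂ (Matrix (Fin N) (Fin N) ℂ[X])) : Set (Matrix (Fin N) (Fin N) ℂ[X]))) ∧
    -- the algebras generated by the eigenvalues of the second-order operators
    (∀ b : ℝ, (MOP.Classical.hermite b).eigAlg = ⊤) ∧
    (∀ (α : ℝ) (hα : -1 < α), (MOP.Classical.laguerre α hα).eigAlg = ⊤) ∧
    (∀ (α β : ℝ) (hα : -1 < α) (hβ : -1 < β),
      (MOP.Classical.jacobi α β hα hβ).eigAlg =
        Algebra.adjoin ℂ {(X * (X + C ((α : ℂ) + β + 1)) : ℂ[X])}) ∧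
    -- (i)
    (∀ w : MOP.Classical, MOP.Classical.lam (w.T w) = 1) ∧
    (∀ w₁ w₂ : MOP.Classical, ¬ MOP.IsDarboux w₂.weight w₁.weight →
      MOP.Classical.lam (w₁.T w₂) = 0) ∧
    -- (ii)
    (∀ (α : ℝ) (k : ℕ) (hα : -1 < α) (hαk : -1 < α + k),
      MOP.Classical.lam ((MOP.Classical.laguerre α hα).T (.laguerre (α + k) hαk)) = 1 ∧
      ∀ n : ℕ,
        (MOP.Classical.lam
          ((MOP.Classical.laguerre (α + k) hαk).T (.laguerre α hα))).eval (n : ℂ) =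
        ((Real.Gamma (n + α + k + 1) / Real.Gamma (n + α + 1) : ℝ) : ℂ)) ∧
    -- (iii)
    (∀ (α β : ℝ) (k : ℕ) (hα : -1 < α) (hβ : -1 < β) (hαk : -1 < α + k) (hβk : -1 < β + k),
      ∀ n : ℕ,
        (MOP.Classical.lam ((MOP.Classical.jacobi α (β + k) hα hβk).T
          (.jacobi (α + k) β hαk hβ))).eval (n : ℂ) =
        ((Real.Gamma (n + β + k + 1) / Real.Gamma (n + β + 1) : ℝ) : ℂ) ∧
        (MOP.Classical.lam ((MOP.Classical.jacobi (α + k) β hαk hβ).T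
          (.jacobi α (β + k) hα hβk))).eval (n : ℂ) =
        ((Real.Gamma (n + α + k + 1) / Real.Gamma (n + α + 1) : ℝ) : ℂ)) := by
  refine ⟨fun N w hw => MOP.eigenvalueAlgebra_directSum hw, MOP.Classical.eigAlg_hermite,
    MOP.Classical.eigAlg_laguerre, MOP.Classical.eigAlg_jacobi, MOP.Classical.lam_T_self,
    fun w₁ w₂ h => ?_, fun α k hα hαk => ⟨?_, fun n => ?_⟩,
    fun α β k hα hβ hαk hβk n => ⟨?_, ?_⟩⟩
  · by_contra h0
    exact h (MOP.Classical.isDarboux_of_lam_T_ne_zero w₁ w₂ h0)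
  · rw [MOP.Classical.T_laguerre_raise hα hαk k rfl]
    exact (MOP.Classical.maps_oneSubPow k α _ hα hαk rfl).lam_eq
  · rw [MOP.Classical.T_laguerre_lower hαk hα k rfl,
      (MOP.Classical.maps_shiftProd_laguerre k _ α hαk hα rfl).lam_eq]
    exact MOP.Classical.eval_risingShift α hα k n
  · rw [MOP.Classical.T_jacobi_raise hα hβk hαk hβ k rfl rfl,
      (MOP.Classical.maps_shiftProd_jacobi_raise k α _ _ β hα hβk hαk hβ rfl rfl).lam_eq]
    exact MOP.Classical.eval_risingShift β hβ k n
  · rw [MOP.Classical.T_jacobi_lower hαk hβ hα hβk k rfl rfl,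
      (MOP.Classical.maps_shiftProd_jacobi_lower k _ β α _ hαk hβ hα hβk rfl rfl).lam_eq]
    exact MOP.Classical.eval_risingShift α hα k n
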